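/- Let $1<\alpha\le 2$. For $\beta>-1$ put $p^{\pm}_\beta(x)=\frac{(1\pm x)^\beta}{\Gamma(\beta+1)}$ on $(-1,1)$ (extended to $\pm1$ where finite), and for $\nu>0$ let $$I^\nu_+f(x)=\int_{-1}^x\frac{(x-s)^{\nu-1}}{\Gamma(\nu)}f(s)\,ds,\qquad I^\nu_-f(x)=\int_x^1\frac{(s-x)^{\nu-1}}{\Gamma(\nu)}f(s)\,ds,$$ with $I^0_\pm f=f$. With $D$ the weak derivative (in the sense of $W^{1,1}[-1,1]$), let $\partial^\alpha_\pm f=D\,I^{2-\alpha}_\pm D f$ and $D^\alpha_+f=D^2I^{2-\alpha}_+f$. All spaces are real. For an interval $\Omega$ with endpoints $-1,1$, $C_0(\Omega)$ is the sup-norm closure of the continuous functions with compact support in $\Omega$. Consider the following six pairs, each consisting of an operator $(A^+,\mathrm{LR})$ on $L_1[-1,1]$ and an operator $(A^-,\mathrm{L'R})$ on $C_0(\Omega)$. The letters name the boundary conditions at $-1$ and $1$: $\mathrm D$ Dirichlet, $\mathrm N$ Neumann (vanishing derivative of order $\alpha-1$), $\mathrm{N^*}$ vanishing first derivative. They are encoded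 in the domains below, where $g$ ranges over the respective space $X=L_1[-1,1]$ or $X=C_0(\Omega)$, $c$ over $\mathbb R$, and the domain consists of the $f\in X$ of the given form. The operators act by the indicated fractional derivative. 1. $\Omega=(-1,1)$. $(\partial^\alpha_+,\mathrm{DD})$: $f=I^\alpha_+g-\frac{I^\alpha_+g(1)}{p^+_{\alpha-1}(1)}p^+_{\alpha-1}$; $(\partial^\alpha_-,\mathrm{DD})$: $f=I^\alpha_-g-\frac{I^\alpha_-g(-1)}{p^-_{\alpha-1}(-1)}p^-_{\alpha-1}$. 2. $\Omega=(-1,1]$. $(\partial^\alpha_+,\mathrm{DN})$: $f=I^\alpha_+g-I^1_+g(1)\,p^+_{\alpha-1}$; $(\partial^\alpha_-,\mathrm{DN})$: $f=I^\alpha_-g-I^\alpha_-g(-1)\,p^-_0$. 3. $\Omega=[-1,1)$. $(\partial^\alpha_+,\mathrm{ND})$: $f=I^\alpha_+g-I^\alpha_+g(1)\,p^+_0$; $(\partial^\alpha_-,\mathrm{ND})$: $f=I^\alpha_-g-I^1_-g(-1)\,p^-_{\alpha-1}$. 4. $\Omega=[-1,1]$. $(\partial^\alpha_+,\mathrm{NN})$: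 $f=I^\alpha_+g-\frac{I^1_+g(1)}{p^+_1(1)}p^+_\alpha+c\,p^+_0$; $(\partial^\alpha_-,\mathrm{NN})$: $f=I^\alpha_-g-\frac{I^1_-g(-1)}{p^-_1(-1)}p^-_\alpha+c\,p^-_0$. 5. $\Omega=[-1,1)$. $(D^\alpha_+,\mathrm{ND})$: $f=I^\alpha_+g-\frac{I^\alpha_+g(1)}{p^+_{\alpha-2}(1)}p^+_{\alpha-2}$; $(\partial^\alpha_-,\mathrm{N^*D})$: $f=I^\alpha_-g-\frac{I^{\alpha-1}_-g(-1)}{p^-_{\alpha-2}(-1)}p^-_{\alpha-1}$. 6. $\Omega=[-1,1]$. $(D^\alpha_+,\mathrm{NN})$: $f=I^\alpha_+g-\frac{I^1_+g(1)}{p^+_1(1)}p^+_\alpha+c\,p^+_{\alpha-2}$; $(\partial^\alpha_-,\mathrm{N^*N})$: $f=I^\alpha_-g-\frac{I^{\alpha-1}_-g(-1)}{p^-_{\alpha-1}(-1)}p^-_\alpha+c\,p^-_0$. The adjoint $A^*$ of an operator $A$ on $X$ is the operator on the dual $X'$ with graph $\{(x',y'):x'(Ax)=y'(x)\text{ for all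 }x\in\mathcal D(A)\}$. Through $\langle\varphi,f\rangle=\int_{-1}^1\varphi f\,dx$ regard $C_0(\Omega)$ as a subspace of $L_1[-1,1]'$ and $L_1[-1,1]$ as a subspace of $C_0(\Omega)'$. The part $B|_Y$ of an operator $B$ in a subspace $Y$ has domain $\{y\in Y\cap\mathcal D(B):By\in Y\}$ and acts as $B$. Then, for each of the six pairs (writing $A^\pm$ for the operators with these domains), $$A^-=(A^+)^*\big|_{C_0(\Omega)}\qquad\text{and}\qquad A^+=(A^-)^*\big|_{L_1[-1,1]},$$ as equalities of operators, domains included. -/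

import Mathlib

open MeasureTheory Set
open scoped ContDiff ZeroAtInfty

namespace FracBC

noncomputable section

/-! ### Power functions and fractional integrals on `[-1, 1]` -/

/-- `p⁺_β(x) = (1 + x)^β / Γ(β + 1)`. -/
def pPlus (β x : ℝ) : ℝ := (1 + x) ^ β / Real.Gamma (β + 1)

/-- `p⁻_β(x) = (1 - x)^β / Γ(β + 1)`. -/
def pMinus (β x : ℝ) : ℝ := (1 - x) ^ β / Real.Gamma (β + 1)

/-- The left-sided fractional integral of order `ν > 0`, based at `-1`; order `0` is the
identity. -/
def intPlus (ν : ℝ) (f : ℝ → ℝ) (x : ℝ) : ℝ :=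
  if ν = 0 then f x else ∫ s in (-1)..x, (x - s) ^ (ν - 1) / Real.Gamma ν * f s

/-- The right-sided fractional integral of order `ν > 0`, based at `1`; order `0` is the
identity. -/
def intMinus (ν : ℝ) (f : ℝ → ℝ) (x : ℝ) : ℝ :=
  if ν = 0 then f x else ∫ s in x..1, (s - x) ^ (ν - 1) / Real.Gamma ν * f s

/-! ### Weak derivatives and fractional derivatives -/

/-- Lebesgue measure on `[-1, 1]`. -/
abbrev muI : Measure ℝ := volume.restrict (Icc (-1) 1)

/-- `F` belongs to `W^{1,1}[-1,1]` and `v` is its weak derivative. -/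
def HasWeakDeriv (F v : ℝ → ℝ) : Prop :=
  Integrable F muI ∧ Integrable v muI ∧
    ∀ φ : ℝ → ℝ, ContDiff ℝ ∞ φ → HasCompactSupport φ → tsupport φ ⊆ Ioo (-1) 1 →
      ∫ x, F x * deriv φ x ∂muI = -∫ x, v x * φ x ∂muI

/-- `∂₊^α f = D I₊^{2-α} D f` exists and equals `u`. -/
def HasCaputoPlus (α : ℝ) (f u : ℝ → ℝ) : Prop :=
  ∃ v, HasWeakDeriv f v ∧ HasWeakDeriv (intPlus (2 - α) v) u

/-- `∂₋^α f = D I₋^{2-α} D f` exists and equals `u`. -/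
def HasCaputoMinus (α : ℝ) (f u : ℝ → ℝ) : Prop :=
  ∃ v, HasWeakDeriv f v ∧ HasWeakDeriv (intMinus (2 - α) v) u

/-- `D₊^α f = D² I₊^{2-α} f` exists and equals `u`. -/
def HasRLPlus (α : ℝ) (f u : ℝ → ℝ) : Prop :=
  ∃ w, HasWeakDeriv (intPlus (2 - α) f) w ∧ HasWeakDeriv w u

/-! ### The six pairs of operators -/

/-- The six pairs (forward operator on `L₁[-1,1]`, backward operator on `C₀(Ω)`). -/
inductive Pair
  /-- `(∂₊^α, DD)` and `(∂₋^α, DD)` -/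
  | caputoDD
  /-- `(∂₊^α, DN)` and `(∂₋^α, DN)` -/
  | caputoDN
  /-- `(∂₊^α, ND)` and `(∂₋^α, ND)` -/
  | caputoND
  /-- `(∂₊^α, NN)` and `(∂₋^α, NN)` -/
  | caputoNN
  /-- `(D₊^α, ND)` and `(∂₋^α, N*D)` -/
  | rlND
  /-- `(D₊^α, NN)` and `(∂₋^α, N*N)` -/
  | rlNN

/-- The interval `Ω`: an endpoint of `[-1, 1]` is removed exactly when there is a Dirichlet
condition at it. -/
def Pair.Omega : Pair → Set ℝ
  | .caputoDD => Ioo (-1) 1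
  | .caputoDN => Ioc (-1) 1
  | .caputoND => Ico (-1) 1
  | .caputoNN => Icc (-1) 1
  | .rlND => Ico (-1) 1
  | .rlNN => Icc (-1) 1

/-- `L₁[-1,1]`. -/
abbrev L1I : Type := Lp ℝ 1 muI

/-- `C₀(Ω)`: continuous functions on `Ω` vanishing at infinity, with the supremum norm. -/
abbrev C0 (i : Pair) : Type := C₀(i.Omega, ℝ)

/-- Extension by zero of a function on `Ω` to the real line. -/
def ext {i : Pair} (φ : C0 i) : ℝ → ℝ := Function.extend Subtype.val φ 0

/-- The domains of the forward operators `(A⁺, LR)` in `L₁[-1,1]`. -/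
def domPlus (α : ℝ) : Pair → Set L1I
  | .caputoDD => {f | ∃ g : L1I, f =ᵐ[muI] fun x =>
      intPlus α g x - intPlus α g 1 / pPlus (α - 1) 1 * pPlus (α - 1) x}
  | .caputoDN => {f | ∃ g : L1I, f =ᵐ[muI] fun x =>
      intPlus α g x - intPlus 1 g 1 * pPlus (α - 1) x}
  | .caputoND => {f | ∃ g : L1I, f =ᵐ[muI] fun x =>
      intPlus α g x - intPlus α g 1 * pPlus 0 x}
  | .caputoNN => {f | ∃ (g : L1I) (c : ℝ), f =ᵐ[muI] fun x =>
      intPlus α g x - intPlus 1 g 1 / pPlus 1 1 * pPlus α x + c * pPlus 0 x}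
  | .rlND => {f | ∃ g : L1I, f =ᵐ[muI] fun x =>
      intPlus α g x - intPlus α g 1 / pPlus (α - 2) 1 * pPlus (α - 2) x}
  | .rlNN => {f | ∃ (g : L1I) (c : ℝ), f =ᵐ[muI] fun x =>
      intPlus α g x - intPlus 1 g 1 / pPlus 1 1 * pPlus α x + c * pPlus (α - 2) x}

/-- The domains of the backward operators `(A⁻, LR)` in `C₀(Ω)`. -/
def domMinus (α : ℝ) : (i : Pair) → Set (C0 i)
  | .caputoDD => {f | ∃ g : C0 .caputoDD, ∀ x, f x =
      intMinus α (ext g) x - intMinus α (ext g) (-1) / pMinus (α - 1) (-1) * pMinus (α - 1) x}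
  | .caputoDN => {f | ∃ g : C0 .caputoDN, ∀ x, f x =
      intMinus α (ext g) x - intMinus α (ext g) (-1) * pMinus 0 x}
  | .caputoND => {f | ∃ g : C0 .caputoND, ∀ x, f x =
      intMinus α (ext g) x - intMinus 1 (ext g) (-1) * pMinus (α - 1) x}
  | .caputoNN => {f | ∃ (g : C0 .caputoNN) (c : ℝ), ∀ x, f x =
      intMinus α (ext g) x - intMinus 1 (ext g) (-1) / pMinus 1 (-1) * pMinus α x
        + c * pMinus 0 x}
  | .rlND => {f | ∃ g : C0 .rlND, ∀ x, f x =
      intMinus α (ext g) x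
        - intMinus (α - 1) (ext g) (-1) / pMinus (α - 2) (-1) * pMinus (α - 1) x}
  | .rlNN => {f | ∃ (g : C0 .rlNN) (c : ℝ), ∀ x, f x =
      intMinus α (ext g) x
        - intMinus (α - 1) (ext g) (-1) / pMinus (α - 1) (-1) * pMinus α x
        + c * pMinus 0 x}

/-- The fractional derivative by which the forward operator acts: `∂₊^α` or `D₊^α`. -/
def HasDerivPlus (α : ℝ) : Pair → (ℝ → ℝ) → (ℝ → ℝ) → Prop
  | .caputoDD | .caputoDN | .caputoND | .caputoNN => HasCaputoPlus α
  | .rlND | .rlNN => HasRLPlus α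

/-- The forward operator `(A⁺, LR)` on `L₁[-1,1]`, as its graph. -/
def opPlus (α : ℝ) (i : Pair) : Set (L1I × L1I) :=
  {q | q.1 ∈ domPlus α i ∧ HasDerivPlus α i q.1 q.2}

/-- The backward operator `(A⁻, LR)` on `C₀(Ω)`, as its graph. -/
def opMinus (α : ℝ) (i : Pair) : Set (C0 i × C0 i) :=
  {q | q.1 ∈ domMinus α i ∧ HasCaputoMinus α (ext q.1) (ext q.2)}

/-! ### Adjoints and parts of operators, in terms of graphs -/

/-- The (graph of the) Banach space adjoint: `x'` is in the domain with image `y'` if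
`x' (A x) = y' x` for all `x` in the domain of `A`. -/
def adjoint {X : Type*} [NormedAddCommGroup X] [NormedSpace ℝ X] (A : Set (X × X)) :
    Set (StrongDual ℝ X × StrongDual ℝ X) :=
  {q | ∀ p ∈ A, q.1 p.2 = q.2 p.1}

/-- The (graph of the) part of an operator `A` on `X` in a space `Y` that is embedded in `X`
by `j`. -/
def partIn {X Y : Type*} (j : Y → X) (A : Set (X × X)) : Set (Y × Y) :=
  {q | (j q.1, j q.2) ∈ A}

/-! ### The embeddings `C₀(Ω) → L₁[-1,1]'` and `L₁[-1,1] → C₀(Ω)'` -/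

theorem measurableSet_Omega (i : Pair) : MeasurableSet i.Omega := by
  cases i <;> simp [Pair.Omega]

theorem measurable_ext {i : Pair} (φ : C0 i) : Measurable (ext φ) :=
  (MeasurableEmbedding.subtype_coe (measurableSet_Omega i)).measurable_extend
    φ.continuous.measurable measurable_zero

theorem ext_apply {i : Pair} (φ : C0 i) (x : i.Omega) : ext φ x = φ x :=
  Subtype.val_injective.extend_apply _ _ _

theorem ext_of_notMem {i : Pair} (φ : C0 i) {x : ℝ} (hx : x ∉ i.Omega) : ext φ x = 0 := by
  rw [ext, Function.extend_apply']
  · rfl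
  · rintro ⟨y, rfl⟩
    exact hx y.2

theorem norm_ext_le {i : Pair} (φ : C0 i) (x : ℝ) : ‖ext φ x‖ ≤ ‖φ‖ := by
  by_cases hx : x ∈ i.Omega
  · rw [ext_apply φ ⟨x, hx⟩]
    exact φ.toBCF.norm_coe_le_norm ⟨x, hx⟩
  · simp [ext_of_notMem φ hx]

theorem ext_add {i : Pair} (φ ψ : C0 i) (x : ℝ) : ext (φ + ψ) x = ext φ x + ext ψ x := by
  by_cases hx : x ∈ i.Omega
  · simp [ext_apply _ ⟨x, hx⟩]
  · simp [ext_of_notMem _ hx]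

theorem ext_smul {i : Pair} (c : ℝ) (φ : C0 i) (x : ℝ) : ext (c • φ) x = c * ext φ x := by
  by_cases hx : x ∈ i.Omega
  · simp [ext_apply _ ⟨x, hx⟩]
  · simp [ext_of_notMem _ hx]

theorem integrable_ext_mul {i : Pair} (φ : C0 i) (f : L1I) :
    Integrable (fun x => ext φ x * f x) muI :=
  (L1.integrable_coeFn f).bdd_mul (measurable_ext φ).aestronglyMeasurable
    (Filter.Eventually.of_forall (norm_ext_le φ))

/-- The pairing `⟨φ, f⟩ = ∫_{-1}^1 φ f`. As it stands it embeds `C₀(Ω)` into the dual of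
`L₁[-1,1]`; flipped, it embeds `L₁[-1,1]` into the dual of `C₀(Ω)`. -/
def pairing (i : Pair) : C0 i →L[ℝ] StrongDual ℝ L1I :=
  LinearMap.mkContinuous₂
    (LinearMap.mk₂ ℝ (fun (φ : C0 i) (f : L1I) => ∫ x, ext φ x * f x ∂muI)
      (fun φ ψ f => by
        rw [← integral_add (integrable_ext_mul φ f) (integrable_ext_mul ψ f)]
        exact integral_congr_ae (Filter.Eventually.of_forall fun x => by
          simp only [ext_add]; ring))
      (fun c φ f => by
        rw [smul_eq_mul, ← integral_const_mul]
        exact integral_congr_ae (Filter.Eventually.of_forall fun x => by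
          simp only [ext_smul]; ring))
      (fun φ f g => by
        rw [← integral_add (integrable_ext_mul φ f) (integrable_ext_mul φ g)]
        refine integral_congr_ae ?_
        filter_upwards [Lp.coeFn_add f g] with x hx
        rw [hx, Pi.add_apply]; ring)
      (fun c φ f => by
        rw [smul_eq_mul, ← integral_const_mul]
        refine integral_congr_ae ?_
        filter_upwards [Lp.coeFn_smul c f] with x hx
        rw [hx, Pi.smul_apply, smul_eq_mul]; ring))
    1
    (fun φ f => by
      rw [LinearMap.mk₂_apply, one_mul, L1.norm_eq_integral_norm, ← integral_const_mul]
      refine norm_integral_le_of_norm_le ((L1.integrable_coeFn f).norm.const_mul _)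
        (Filter.Eventually.of_forall fun x => ?_)
      rw [norm_mul]
      exact mul_le_mul_of_nonneg_right (norm_ext_le φ x) (norm_nonneg _))

theorem pairing_apply (i : Pair) (φ : C0 i) (f : L1I) :
    pairing i φ f = ∫ x, ext φ x * f x ∂muI := rfl

end

end FracBC

/-! Everything reduces to two transposition facts. By Fubini, the transpose of `I₊^α` under the
pairing is `I₋^α`, since both have the kernel `(x - s)₊^(α-1)/Γ(α)` (`integral_mul_intPlus`). The
boundary functionals are themselves pairings with power functions: `I₋^ν g(-1) = ⟨g, p⁺_{ν-1}⟩` and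
`I₊^ν g(1) = ⟨p⁻_{ν-1}, g⟩` (`intMinus_neg_one`, `intPlus_one_right`).

The fractional derivative undoes `I^α` and annihilates the added power function, and weak
derivatives are unique, so each graph can be written explicitly in terms of the image. With a
Dirichlet condition at some endpoint, `A⁺` is the inverse of `g ↦ I₊^α g - ⟨b, g⟩ a`, and `A⁻` is
the inverse of `ψ ↦ I₋^α ψ - ⟨ψ, a⟩ b`. These are transposes of each other, whence both adjoint
identities (`adjoint_rankOne`).

Without a Dirichlet condition neither operator is injective. There `A⁺` relates `I₊^α g + c a` to
`g` with `∫ g = 0`, and `A⁻` relates `I₋^α ψ + c` to `ψ` with `⟨ψ, a⟩ = 0`. The kernel of each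
operator is spanned by the function that defines the range condition of the other, and `∫ a ≠ 0`
allows projection onto these ranges (`adjoint_of_kernel`). -/

namespace FracBC

/-! ### The convolution kernel of the fractional integrals -/

/-- The kernel `t₊^(ν-1) / Γ(ν)`. -/
noncomputable def kern (ν t : ℝ) : ℝ := if 0 < t then t ^ (ν - 1) / Real.Gamma ν else 0

theorem kern_of_pos {ν t : ℝ} (ht : 0 < t) : kern ν t = t ^ (ν - 1) / Real.Gamma ν := if_pos ht

theorem kern_of_nonpos {ν t : ℝ} (ht : t ≤ 0) : kern ν t = 0 := if_neg ht.not_gt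

theorem measurable_kern (ν : ℝ) : Measurable (kern ν) :=
  Measurable.ite measurableSet_Ioi ((measurable_id.pow_const _).div_const _) measurable_const

theorem kern_nonneg {ν : ℝ} (hν : 0 < ν) (t : ℝ) : 0 ≤ kern ν t := by
  rcases lt_or_ge 0 t with ht | ht
  · rw [kern_of_pos ht]
    have := Real.Gamma_pos_of_pos hν
    positivity
  · rw [kern_of_nonpos ht]

/-- The window `[-2, 2]` contains all differences of points of `[-1, 1]`. -/
theorem integrableOn_kern {ν : ℝ} (hν : 0 < ν) : IntegrableOn (kern ν) (Icc (-2) 2) := by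
  have h : IntegrableOn (fun t : ℝ => t ^ (ν - 1) / Real.Gamma ν) (Ioc 0 2) := by
    have := (intervalIntegral.intervalIntegrable_rpow' (a := 0) (b := 2)
      (r := ν - 1) (by linarith)).div_const (Real.Gamma ν)
    rwa [intervalIntegrable_iff_integrableOn_Ioc_of_le (by norm_num)] at this
  have h2 : IntegrableOn (kern ν) (Ioc 0 2) :=
    h.congr_fun (fun t ht => (kern_of_pos ht.1).symm) measurableSet_Ioc
  have h3 : IntegrableOn (kern ν) (Icc (-2) 0) :=
    (integrableOn_zero (μ := volume) (s := Icc (-2 : ℝ) 0)).congr_fun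
      (fun t ht => (kern_of_nonpos ht.2).symm) measurableSet_Icc
  rw [← Icc_union_Ioc_eq_Icc (b := (0 : ℝ)) (by norm_num) (by norm_num)]
  exact h3.union h2

/-- For order at least one the kernel has no singularity. This is what later gives identities at
every point, endpoints included, instead of almost everywhere. -/
theorem exists_kern_le {ν : ℝ} (hν : 1 ≤ ν) : ∃ C, ∀ t ≤ 2, ‖kern ν t‖ ≤ C := by
  refine ⟨2 ^ (ν - 1) / Real.Gamma ν, fun t ht => ?_⟩
  have hG := Real.Gamma_pos_of_pos (show 0 < ν by linarith)
  rw [Real.norm_of_nonneg (kern_nonneg (by linarith) t)]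
  rcases lt_or_ge 0 t with h0 | h0
  · rw [kern_of_pos h0]
    gcongr
  · rw [kern_of_nonpos h0]
    positivity

/-- Euler's Beta integral, transferred from the complex one: on `[0, a]` all bases are nonnegative,
so complex powers are casts of real ones. -/
theorem integral_rpow_mul_rpow {μ ν a : ℝ} (hμ : 0 < μ) (hν : 0 < ν) (ha : 0 < a) :
    ∫ t in 0..a, t ^ (ν - 1) * (a - t) ^ (μ - 1) =
      a ^ (μ + ν - 1) * (Real.Gamma μ * Real.Gamma ν / Real.Gamma (μ + ν)) := by
  have h := Complex.betaIntegral_scaled ν μ ha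
  have hG := Complex.Gamma_mul_Gamma_eq_betaIntegral (s := ν) (t := μ) (by simpa) (by simpa)
  have h0 := Real.Gamma_pos_of_pos (add_pos hμ hν)
  rw [← Complex.ofReal_add, Complex.Gamma_ofReal, Complex.Gamma_ofReal, Complex.Gamma_ofReal] at hG
  have h1 : Complex.betaIntegral ν μ =
      ((Real.Gamma μ * Real.Gamma ν / Real.Gamma (μ + ν) : ℝ) : ℂ) := by
    have h0' : (Real.Gamma (μ + ν) : ℂ) ≠ 0 := by exact_mod_cast h0.ne'
    push_cast
    rw [eq_div_iff h0', mul_comm, add_comm μ ν, ← hG, mul_comm]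
  rw [h1] at h
  have h2 : ∫ t in 0..a, ((t : ℂ) ^ ((ν : ℂ) - 1) * ((a : ℂ) - t) ^ ((μ : ℂ) - 1)) =
      ((∫ t in 0..a, t ^ (ν - 1) * (a - t) ^ (μ - 1) : ℝ) : ℂ) := by
    rw [← intervalIntegral.integral_ofReal]
    refine intervalIntegral.integral_congr fun t ht => ?_
    rw [uIcc_of_le ha.le] at ht
    push_cast
    rw [Complex.ofReal_cpow ht.1, Complex.ofReal_cpow (sub_nonneg.2 ht.2)]
    push_cast
    rfl
  rw [h2] at h
  have h3 : (a : ℂ) ^ ((ν : ℂ) + μ - 1) = ((a ^ (μ + ν - 1) : ℝ) : ℂ) := by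
    rw [Complex.ofReal_cpow ha.le, add_comm μ ν]
    push_cast
    rfl
  rw [h3] at h
  exact_mod_cast h

theorem setIntegral_kern_mul_kern {μ ν s x : ℝ} (hμ : 0 < μ) (hν : 0 < ν) (hsx : s < x) :
    ∫ r in Ioo s x, kern μ (x - r) * kern ν (r - s) = kern (μ + ν) (x - s) := by
  have h0 := (Real.Gamma_pos_of_pos (add_pos hμ hν)).ne'
  have h1 := (Real.Gamma_pos_of_pos hμ).ne'
  have h2 := (Real.Gamma_pos_of_pos hν).ne'
  have h := integral_rpow_mul_rpow hμ hν (sub_pos.2 hsx)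
  have h3 := intervalIntegral.integral_comp_sub_right (a := s) (b := x)
    (fun t => t ^ (ν - 1) * (x - s - t) ^ (μ - 1)) s
  rw [sub_self, h, intervalIntegral.integral_of_le hsx.le, integral_Ioc_eq_integral_Ioo] at h3
  rw [kern_of_pos (sub_pos.2 hsx)]
  have h4 : ∫ r in Ioo s x, kern μ (x - r) * kern ν (r - s) =
      ∫ r in Ioo s x, (Real.Gamma μ * Real.Gamma ν)⁻¹ *
        ((r - s) ^ (ν - 1) * (x - s - (r - s)) ^ (μ - 1)) := by
    refine setIntegral_congr_fun measurableSet_Ioo fun r hr => ?_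
    rw [kern_of_pos (sub_pos.2 hr.1), kern_of_pos (sub_pos.2 hr.2),
      show x - s - (r - s) = x - r by ring]
    field_simp
  rw [h4, integral_const_mul, h3]
  field_simp

/-- The kernels form a convolution semigroup. The integrand lives on `(s, x)`, which lies inside
`[-1, 1]`, so restricting the measure loses nothing. -/
theorem integral_kern_mul_kern {μ ν s x : ℝ} (hμ : 0 < μ) (hν : 0 < ν) (hs : -1 ≤ s)
    (hx : x ≤ 1) : ∫ r, kern μ (x - r) * kern ν (r - s) ∂muI = kern (μ + ν) (x - s) := by
  have h0 : ∀ r ∉ Ioo s x, kern μ (x - r) * kern ν (r - s) = 0 := by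
    intro r hr
    rcases le_or_gt r s with h | h
    · rw [kern_of_nonpos (sub_nonpos.2 h), mul_zero]
    · rw [kern_of_nonpos (ν := μ) (sub_nonpos.2 (not_lt.1 fun h' => hr ⟨h, h'⟩)), zero_mul]
  rw [setIntegral_eq_of_subset_of_forall_sdiff_eq_zero (s := Ioo s x) measurableSet_Icc
    (fun r hr => ⟨hs.trans hr.1.le, hr.2.le.trans hx⟩) fun r hr => h0 r hr.2]
  rcases lt_or_ge s x with h | h
  · exact setIntegral_kern_mul_kern hμ hν h
  · rw [Ioo_eq_empty h.not_gt, kern_of_nonpos (sub_nonpos.2 h)]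
    simp

theorem integrable_kern_mul_kern {μ ν s x : ℝ} (hμ : 0 < μ) (hν : 0 < ν) (hs : -1 ≤ s)
    (hx : x ≤ 1) : Integrable (fun r => kern μ (x - r) * kern ν (r - s)) muI := by
  rcases lt_or_ge s x with h | h
  -- A Bochner integral of a non-integrable function is zero by convention, so the positive value
  -- just computed proves integrability.
  · refine Integrable.of_integral_ne_zero ?_
    rw [integral_kern_mul_kern hμ hν hs hx, kern_of_pos (sub_pos.2 h)]
    have := Real.Gamma_pos_of_pos (add_pos hμ hν)
    have := sub_pos.2 h
    positivity
  · have : (fun r => kern μ (x - r) * kern ν (r - s)) = 0 := by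
      ext r
      rcases le_or_gt r s with h' | h'
      · simp [kern_of_nonpos (sub_nonpos.2 h')]
      · simp [kern_of_nonpos (sub_nonpos.2 (h.trans h'.le))]
    rw [this]
    exact integrable_zero _ _ _

/-- The kernel of a fractional integral applied to an integrable function is integrable on the
square. -/
theorem integrable_kern_sub_mul {ν : ℝ} (hν : 0 < ν) {g : ℝ → ℝ} (hg : Integrable g muI) :
    Integrable (fun p : ℝ × ℝ => kern ν (p.1 - p.2) * g p.2) (muI.prod muI) := by
  -- Kernel and function are cut off and extended by zero, so that the integrand of a convolution on
  -- the whole line agrees with the desired one on the square.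
  have h1 : Integrable ((Icc (-2) 2).indicator (kern ν)) volume :=
    (integrableOn_kern hν).integrable_indicator measurableSet_Icc
  have h2 : Integrable ((Icc (-1) 1).indicator g) volume :=
    IntegrableOn.integrable_indicator hg measurableSet_Icc
  have h3 := (h2.convolution_integrand (ContinuousLinearMap.mul ℝ ℝ) h1).integrableOn
    (s := Icc (-1) 1 ×ˢ Icc (-1) 1)
  rw [Measure.prod_restrict]
  refine IntegrableOn.congr_fun h3 (fun p hp => ?_) (measurableSet_Icc.prod measurableSet_Icc)
  obtain ⟨⟨h1, h2⟩, h3, h4⟩ := hp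
  have h5 : p.2 ∈ Icc (-1 : ℝ) 1 := ⟨h3, h4⟩
  have h6 : p.1 - p.2 ∈ Icc (-2 : ℝ) 2 := ⟨by linarith, by linarith⟩
  simp only [ContinuousLinearMap.mul_apply', indicator_of_mem h5, indicator_of_mem h6, mul_comm]

/-! ### Reflection -/

theorem measurePreserving_neg_muI : MeasurePreserving (fun x : ℝ => -x) muI muI := by
  have h := (Measure.measurePreserving_neg (volume : Measure ℝ)).restrict_preimage
    (s := Icc (-1) 1) measurableSet_Icc
  simpa using h

theorem integral_comp_neg_muI (f : ℝ → ℝ) : ∫ x, f (-x) ∂muI = ∫ x, f x ∂muI :=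
  measurePreserving_neg_muI.integral_comp (Homeomorph.neg ℝ).measurableEmbedding f

theorem integrable_comp_neg_muI {f : ℝ → ℝ} (hf : Integrable f muI) :
    Integrable (fun x => f (-x)) muI :=
  measurePreserving_neg_muI.integrable_comp_of_integrable hf

theorem ae_eq_comp_neg_muI {f g : ℝ → ℝ} (h : f =ᵐ[muI] g) :
    (fun x => f (-x)) =ᵐ[muI] fun x => g (-x) :=
  measurePreserving_neg_muI.quasiMeasurePreserving.ae_eq_comp h

/-- Reflection preserves `muI`, so right-sided facts are deduced from left-sided ones. -/
theorem intMinus_eq_intPlus_neg (ν : ℝ) (f : ℝ → ℝ) (x : ℝ) :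
    intMinus ν f x = intPlus ν (fun s => f (-s)) (-x) := by
  unfold intMinus intPlus
  split_ifs with h
  · simp
  · have := intervalIntegral.integral_comp_neg (a := -1) (b := -x)
      (fun s => (s - x) ^ (ν - 1) / Real.Gamma ν * f s)
    rw [neg_neg, neg_neg] at this
    rw [← this]
    refine intervalIntegral.integral_congr fun s _ => ?_
    simp only
    rw [show -s - x = -x - s by ring]

theorem pMinus_eq_pPlus_neg (β x : ℝ) : pMinus β x = pPlus β (-x) := by
  simp [pMinus, pPlus, sub_eq_add_neg]

/-! ### Fractional integrals as kernel operators -/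

theorem intPlus_eq {ν : ℝ} (hν : 0 < ν) (f : ℝ → ℝ) {x : ℝ} (hx : x ∈ Icc (-1) 1) :
    intPlus ν f x = ∫ s, kern ν (x - s) * f s ∂muI := by
  -- The endpoint `s = x` must be dropped: for `ν = 1` the power there is `0 ^ 0 = 1`, while `kern`
  -- is `0`.
  rw [intPlus, if_neg hν.ne', intervalIntegral.integral_of_le hx.1, integral_Ioc_eq_integral_Ioo,
    ← integral_Ico_eq_integral_Ioo,
    setIntegral_eq_of_subset_of_forall_sdiff_eq_zero (s := Ico (-1) x) measurableSet_Icc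
      (fun r hr => ⟨hr.1, hr.2.le.trans hx.2⟩)]
  · refine setIntegral_congr_fun measurableSet_Ico fun s hs => ?_
    simp only [kern_of_pos (sub_pos.2 hs.2)]
  · intro r hr
    rw [kern_of_nonpos, zero_mul]
    exact sub_nonpos.2 (not_lt.1 fun h => hr.2 ⟨hr.1.1, h⟩)

theorem intMinus_eq {ν : ℝ} (hν : 0 < ν) (f : ℝ → ℝ) {x : ℝ} (hx : x ∈ Icc (-1) 1) :
    intMinus ν f x = ∫ s, kern ν (s - x) * f s ∂muI := by
  rw [intMinus_eq_intPlus_neg, intPlus_eq hν _ ⟨by linarith [hx.2], by linarith [hx.1]⟩,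
    ← integral_comp_neg_muI]
  refine integral_congr_ae (Filter.Eventually.of_forall fun s => ?_)
  simp only [neg_neg]
  rw [show -x - -s = s - x by ring]

theorem intPlus_zero_order (f : ℝ → ℝ) : intPlus 0 f = f := by
  ext x
  simp [intPlus]

theorem intPlus_congr {ν : ℝ} (hν : 0 < ν) {f g : ℝ → ℝ} (h : f =ᵐ[muI] g) {x : ℝ}
    (hx : x ∈ Icc (-1) 1) : intPlus ν f x = intPlus ν g x := by
  rw [intPlus_eq hν _ hx, intPlus_eq hν _ hx]
  refine integral_congr_ae ?_
  filter_upwards [h] with s hs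
  rw [hs]

theorem ae_mem_Icc : ∀ᵐ x ∂muI, x ∈ Icc (-1 : ℝ) 1 := ae_restrict_mem measurableSet_Icc

theorem ae_mem_Ioo : ∀ᵐ x ∂muI, x ∈ Ioo (-1 : ℝ) 1 := by
  rw [muI, ← restrict_Ioo_eq_restrict_Icc]
  exact ae_restrict_mem measurableSet_Ioo

theorem intPlus_ae_congr {ν : ℝ} (hν : 0 ≤ ν) {f g : ℝ → ℝ} (h : f =ᵐ[muI] g) :
    intPlus ν f =ᵐ[muI] intPlus ν g := by
  rcases hν.eq_or_lt with rfl | hν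
  · simpa only [intPlus_zero_order] using h
  · filter_upwards [ae_mem_Icc] with x hx using intPlus_congr hν h hx

theorem intMinus_congr {ν : ℝ} (hν : 0 < ν) {f g : ℝ → ℝ} (h : f =ᵐ[muI] g) {x : ℝ}
    (hx : x ∈ Icc (-1) 1) : intMinus ν f x = intMinus ν g x := by
  rw [intMinus_eq_intPlus_neg, intMinus_eq_intPlus_neg]
  exact intPlus_congr hν (ae_eq_comp_neg_muI h) ⟨by linarith [hx.2], by linarith [hx.1]⟩

theorem integrable_intPlus {ν : ℝ} (hν : 0 ≤ ν) {g : ℝ → ℝ} (hg : Integrable g muI) :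
    Integrable (intPlus ν g) muI := by
  rcases hν.eq_or_lt with rfl | hν
  · rwa [intPlus_zero_order]
  · refine (integrable_kern_sub_mul hν hg).integral_prod_left.congr ?_
    filter_upwards [ae_mem_Icc] with x hx using (intPlus_eq hν g hx).symm

theorem intPlus_const_mul {ν : ℝ} (c : ℝ) (f : ℝ → ℝ) (x : ℝ) :
    intPlus ν (fun s => c * f s) x = c * intPlus ν f x := by
  unfold intPlus
  split_ifs
  · rfl
  · rw [← intervalIntegral.integral_const_mul]
    exact intervalIntegral.integral_congr fun s _ => by ring

/-- For order below one the sections of the kernel are integrable only for almost every `x`, so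
additivity holds only almost everywhere. -/
theorem intPlus_ae_add {ν : ℝ} (hν : 0 ≤ ν) {f g : ℝ → ℝ} (hf : Integrable f muI)
    (hg : Integrable g muI) :
    intPlus ν (fun s => f s + g s) =ᵐ[muI] fun x => intPlus ν f x + intPlus ν g x := by
  rcases hν.eq_or_lt with rfl | hν
  · simp only [intPlus_zero_order]
    rfl
  · filter_upwards [ae_mem_Icc, (integrable_kern_sub_mul hν hf).prod_right_ae,
      (integrable_kern_sub_mul hν hg).prod_right_ae] with x hx h1 h2
    rw [intPlus_eq hν _ hx, intPlus_eq hν _ hx, intPlus_eq hν _ hx, ← integral_add h1 h2]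
    exact integral_congr_ae (Filter.Eventually.of_forall fun s => by ring)

theorem integrable_kern_sub_mul_of_one_le {ν : ℝ} (hν : 1 ≤ ν) {g : ℝ → ℝ}
    (hg : Integrable g muI) {x : ℝ} (hx : x ∈ Icc (-1) 1) :
    Integrable (fun s => kern ν (x - s) * g s) muI := by
  obtain ⟨C, hC⟩ := exists_kern_le hν
  refine hg.bdd_mul (c := C)
    ((measurable_kern ν).comp (measurable_const.sub measurable_id)).aestronglyMeasurable ?_
  filter_upwards [ae_mem_Icc] with s hs
  exact hC _ (by linarith [hx.2, hs.1])

theorem intPlus_add {ν : ℝ} (hν : 1 ≤ ν) {f g : ℝ → ℝ} (hf : Integrable f muI)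
    (hg : Integrable g muI) {x : ℝ} (hx : x ∈ Icc (-1) 1) :
    intPlus ν (fun s => f s + g s) x = intPlus ν f x + intPlus ν g x := by
  have hν' : 0 < ν := by linarith
  rw [intPlus_eq hν' _ hx, intPlus_eq hν' _ hx, intPlus_eq hν' _ hx, ← integral_add
    (integrable_kern_sub_mul_of_one_le hν hf hx) (integrable_kern_sub_mul_of_one_le hν hg hx)]
  exact integral_congr_ae (Filter.Eventually.of_forall fun s => by ring)

theorem intMinus_const_mul {ν : ℝ} (c : ℝ) (f : ℝ → ℝ) (x : ℝ) :
    intMinus ν (fun s => c * f s) x = c * intMinus ν f x := by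
  simp only [intMinus_eq_intPlus_neg, intPlus_const_mul]

theorem intMinus_add {ν : ℝ} (hν : 1 ≤ ν) {f g : ℝ → ℝ} (hf : Integrable f muI)
    (hg : Integrable g muI) {x : ℝ} (hx : x ∈ Icc (-1) 1) :
    intMinus ν (fun s => f s + g s) x = intMinus ν f x + intMinus ν g x := by
  simp only [intMinus_eq_intPlus_neg]
  exact intPlus_add hν (integrable_comp_neg_muI hf) (integrable_comp_neg_muI hg)
    ⟨by linarith [hx.2], by linarith [hx.1]⟩

/-- Fractional integration by parts. -/
theorem integral_mul_intPlus {ν : ℝ} (hν : 0 < ν) {f g : ℝ → ℝ} {C : ℝ}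
    (hf : AEStronglyMeasurable f muI) (hC : ∀ x ∈ Icc (-1) 1, ‖f x‖ ≤ C)
    (hg : Integrable g muI) :
    ∫ x, f x * intPlus ν g x ∂muI = ∫ x, intMinus ν f x * g x ∂muI := by
  have hint : Integrable (fun p : ℝ × ℝ => f p.1 * (kern ν (p.1 - p.2) * g p.2))
      (muI.prod muI) := by
    refine (integrable_kern_sub_mul hν hg).bdd_mul (c := C) hf.comp_fst ?_
    have : ∀ᵐ p ∂muI.prod muI, p.1 ∈ Icc (-1 : ℝ) 1 :=
      Measure.quasiMeasurePreserving_fst.ae ae_mem_Icc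
    filter_upwards [this] with p hp using hC _ hp
  calc ∫ x, f x * intPlus ν g x ∂muI
      = ∫ x, ∫ s, f x * (kern ν (x - s) * g s) ∂muI ∂muI := by
        refine integral_congr_ae ?_
        filter_upwards [ae_mem_Icc] with x hx
        rw [intPlus_eq hν g hx, integral_const_mul]
    _ = ∫ s, ∫ x, f x * (kern ν (x - s) * g s) ∂muI ∂muI := integral_integral_swap hint
    _ = ∫ x, intMinus ν f x * g x ∂muI := by
        refine integral_congr_ae ?_
        filter_upwards [ae_mem_Icc] with s hs
        rw [intMinus_eq hν f hs, ← integral_mul_const]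
        exact integral_congr_ae (Filter.Eventually.of_forall fun x => by ring)

/-- The semigroup property of the fractional integrals. -/
theorem intPlus_intPlus {μ ν : ℝ} (hμ : 0 < μ) (hν : 0 < ν) (hμν : 1 ≤ μ + ν) {g : ℝ → ℝ}
    (hg : Integrable g muI) {x : ℝ} (hx : x ∈ Icc (-1) 1) :
    intPlus μ (intPlus ν g) x = intPlus (μ + ν) g x := by
  have hmeas : AEStronglyMeasurable
      (fun p : ℝ × ℝ => kern μ (x - p.1) * kern ν (p.1 - p.2) * g p.2) (muI.prod muI) := by
    refine AEStronglyMeasurable.mul ?_ hg.1.comp_snd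
    exact (((measurable_kern μ).comp (measurable_const.sub measurable_fst)).mul
      ((measurable_kern ν).comp (measurable_fst.sub measurable_snd))).aestronglyMeasurable
  have hint : Integrable
      (fun p : ℝ × ℝ => kern μ (x - p.1) * kern ν (p.1 - p.2) * g p.2) (muI.prod muI) := by
    rw [integrable_prod_iff' hmeas]
    constructor
    · filter_upwards [ae_mem_Icc] with s hs
      exact (integrable_kern_mul_kern hμ hν hs.1 hx.2).mul_const _
    -- The inner integral of the absolute value is `kern (μ + ν) (x - s) * |g s|`; the bound `1 ≤ μ
    -- + ν` makes it integrable for every `x`, with no exceptional null set.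
    · refine (integrable_kern_sub_mul_of_one_le hμν hg.norm hx).congr ?_
      filter_upwards [ae_mem_Icc] with s hs
      simp only [norm_mul, Real.norm_of_nonneg (kern_nonneg hμ _),
        Real.norm_of_nonneg (kern_nonneg hν _)]
      rw [integral_mul_const, integral_kern_mul_kern hμ hν hs.1 hx.2]
  calc intPlus μ (intPlus ν g) x
      = ∫ r, ∫ s, kern μ (x - r) * kern ν (r - s) * g s ∂muI ∂muI := by
        rw [intPlus_eq hμ _ hx]
        refine integral_congr_ae ?_
        filter_upwards [ae_mem_Icc] with r hr
        rw [intPlus_eq hν g hr, ← integral_const_mul]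
        exact integral_congr_ae (Filter.Eventually.of_forall fun s => by ring)
    _ = ∫ s, ∫ r, kern μ (x - r) * kern ν (r - s) * g s ∂muI ∂muI := integral_integral_swap hint
    _ = intPlus (μ + ν) g x := by
        rw [intPlus_eq (add_pos hμ hν) _ hx]
        refine integral_congr_ae ?_
        filter_upwards [ae_mem_Icc] with s hs
        rw [integral_mul_const, integral_kern_mul_kern hμ hν hs.1 hx.2]

/-! ### Power functions -/

theorem pPlus_eq_kern {β x : ℝ} (hx : -1 < x) : pPlus β x = kern (β + 1) (x + 1) := by
  rw [pPlus, kern_of_pos (by linarith), add_sub_cancel_right, add_comm]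

/-- At `x = -1` the identity fails for `β = 0`, where `0 ^ 0 = 1` but the kernel vanishes. -/
theorem pPlus_eq_kern_of_pos {β x : ℝ} (hβ : 0 < β) (hx : -1 ≤ x) :
    pPlus β x = kern (β + 1) (x + 1) := by
  rcases hx.eq_or_lt with rfl | hx
  · simp [pPlus, kern_of_nonpos, Real.zero_rpow hβ.ne']
  · exact pPlus_eq_kern hx

theorem pPlus_ae_eq_kern (β : ℝ) : pPlus β =ᵐ[muI] fun x => kern (β + 1) (x + 1) := by
  filter_upwards [ae_mem_Ioo] with x hx using pPlus_eq_kern hx.1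

theorem pPlus_zero (x : ℝ) : pPlus 0 x = 1 := by simp [pPlus]

theorem pMinus_zero (x : ℝ) : pMinus 0 x = 1 := by simp [pMinus]

theorem integrable_pPlus {β : ℝ} (hβ : -1 < β) : Integrable (pPlus β) muI := by
  have h1 : Integrable ((Icc (-2) 2).indicator (kern (β + 1))) volume :=
    (integrableOn_kern (by linarith)).integrable_indicator measurableSet_Icc
  refine ((h1.comp_add_right 1).integrableOn (s := Icc (-1) 1)).congr ?_
  filter_upwards [ae_mem_Ioo] with x hx
  have h : x + 1 ∈ Icc (-2 : ℝ) 2 := ⟨by linarith [hx.1], by linarith [hx.2]⟩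
  rw [indicator_of_mem h, pPlus_eq_kern hx.1]

/-- Power functions are kernels with source `s = -1`, so this is the semigroup identity. -/
theorem intPlus_pPlus_eq_kern {μ β : ℝ} (hμ : 0 < μ) (hβ : -1 < β) {x : ℝ}
    (hx : x ∈ Icc (-1) 1) : intPlus μ (pPlus β) x = kern (μ + β + 1) (x + 1) := by
  rw [intPlus_congr hμ (pPlus_ae_eq_kern β) hx, intPlus_eq hμ _ hx]
  have h := integral_kern_mul_kern hμ (show 0 < β + 1 by linarith) le_rfl hx.2
  simpa only [sub_neg_eq_add, ← add_assoc] using h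

theorem intPlus_pPlus {μ β : ℝ} (hμ : 0 < μ) (hβ : -1 < β) (h : 0 < μ + β) {x : ℝ}
    (hx : x ∈ Icc (-1) 1) : intPlus μ (pPlus β) x = pPlus (μ + β) x := by
  rw [intPlus_pPlus_eq_kern hμ hβ hx, pPlus_eq_kern_of_pos h hx.1]

theorem intPlus_pPlus_ae {μ β : ℝ} (hμ : 0 ≤ μ) (hβ : -1 < β) :
    intPlus μ (pPlus β) =ᵐ[muI] pPlus (μ + β) := by
  rcases hμ.eq_or_lt with rfl | hμ
  · rw [intPlus_zero_order, zero_add]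
  · filter_upwards [ae_mem_Ioo] with x hx
    rw [intPlus_pPlus_eq_kern hμ hβ (Ioo_subset_Icc_self hx), pPlus_eq_kern hx.1]

theorem intPlus_one_fun {μ : ℝ} (hμ : 0 < μ) {x : ℝ} (hx : x ∈ Icc (-1) 1) :
    intPlus μ (fun _ => 1) x = pPlus μ x := by
  have h := intPlus_pPlus hμ (β := 0) (by norm_num) (by simpa) hx
  rwa [add_zero, show pPlus 0 = fun _ => 1 from funext pPlus_zero] at h

theorem intMinus_one_fun {μ : ℝ} (hμ : 0 < μ) {x : ℝ} (hx : x ∈ Icc (-1) 1) :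
    intMinus μ (fun _ => 1) x = pMinus μ x := by
  rw [intMinus_eq_intPlus_neg, pMinus_eq_pPlus_neg,
    intPlus_one_fun hμ ⟨by linarith [hx.2], by linarith [hx.1]⟩]

/-- Turns the boundary values in the domains into pairings, so that the correction terms can be
transposed. -/
theorem intMinus_neg_one {ν : ℝ} (hν : 0 < ν) (g : ℝ → ℝ) :
    intMinus ν g (-1) = ∫ s, g s * pPlus (ν - 1) s ∂muI := by
  rw [intMinus_eq hν _ (by simp)]
  refine integral_congr_ae ?_
  filter_upwards [pPlus_ae_eq_kern (ν - 1)] with s hs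
  rw [hs, sub_add_cancel, sub_neg_eq_add, mul_comm]

theorem intPlus_one_right {ν : ℝ} (hν : 0 < ν) (g : ℝ → ℝ) :
    intPlus ν g 1 = ∫ s, pMinus (ν - 1) s * g s ∂muI := by
  have h := intMinus_neg_one hν fun s => g (-s)
  rw [intMinus_eq_intPlus_neg] at h
  simp only [neg_neg] at h
  rw [h, ← integral_comp_neg_muI]
  simp only [neg_neg, pMinus_eq_pPlus_neg, mul_comm]

theorem neg_mem_Icc {x : ℝ} (hx : x ∈ Icc (-1 : ℝ) 1) : -x ∈ Icc (-1 : ℝ) 1 :=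
  ⟨by linarith [hx.2], by linarith [hx.1]⟩

theorem intPlus_order_one (v : ℝ → ℝ) (x : ℝ) : intPlus 1 v x = ∫ s in (-1)..x, v s := by
  simp [intPlus]

theorem intMinus_order_one (v : ℝ → ℝ) (x : ℝ) : intMinus 1 v x = ∫ s in x..1, v s := by
  simp [intMinus]

theorem continuousOn_intPlus_one {v : ℝ → ℝ} (hv : Integrable v muI) :
    ContinuousOn (intPlus 1 v) (Icc (-1) 1) := by
  have h := intervalIntegral.continuousOn_primitive_interval (f := v) (μ := volume)
    (a := -1) (b := 1) (by rwa [uIcc_of_le (by norm_num)])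
  rw [uIcc_of_le (by norm_num)] at h
  exact h.congr fun x _ => intPlus_order_one v x

theorem intPlus_one_intPlus {α : ℝ} (hα : 1 < α) {g : ℝ → ℝ} (hg : Integrable g muI) {x : ℝ}
    (hx : x ∈ Icc (-1) 1) : intPlus 1 (intPlus (α - 1) g) x = intPlus α g x := by
  rw [intPlus_intPlus one_pos (by linarith) (by linarith) hg hx, add_sub_cancel]

/-- As `α > 1`, `I^α g` is a primitive of the integrable function `I^{α-1} g`. -/
theorem continuousOn_intPlus {α : ℝ} (hα : 1 < α) {g : ℝ → ℝ} (hg : Integrable g muI) :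
    ContinuousOn (intPlus α g) (Icc (-1) 1) :=
  (continuousOn_intPlus_one (integrable_intPlus (by linarith) hg)).congr fun _ hx =>
    (intPlus_one_intPlus hα hg hx).symm

theorem continuousOn_intMinus {α : ℝ} (hα : 1 < α) {g : ℝ → ℝ} (hg : Integrable g muI) :
    ContinuousOn (intMinus α g) (Icc (-1) 1) :=
  ((continuousOn_intPlus hα (integrable_comp_neg_muI hg)).comp continuous_neg.continuousOn
    fun _ hx => neg_mem_Icc hx).congr fun x _ => intMinus_eq_intPlus_neg α g x

theorem continuous_pMinus {β : ℝ} (hβ : 0 ≤ β) : Continuous (pMinus β) :=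
  ((continuous_const.sub continuous_id).rpow_const fun _ => Or.inr hβ).div_const _

/-! ### Weak derivatives -/

/-- An integrable function that annihilates the test functions vanishes. -/
theorem ae_eq_zero_of_integral_test_eq_zero {r : ℝ → ℝ} (hr : Integrable r muI)
    (h : ∀ φ : ℝ → ℝ, ContDiff ℝ ∞ φ → HasCompactSupport φ → tsupport φ ⊆ Ioo (-1) 1 →
      ∫ x, φ x * r x ∂muI = 0) : r =ᵐ[muI] 0 := by
  have h1 := isOpen_Ioo.ae_eq_zero_of_integral_contDiff_smul_eq_zero (U := Ioo (-1 : ℝ) 1)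
    (μ := muI) (hr.locallyIntegrable.locallyIntegrableOn _) fun φ h1 h2 h3 => by
      simpa using h φ h1 h2 h3
  filter_upwards [h1, ae_mem_Ioo] with x hx hx' using hx hx'

theorem integrable_mul_test {F φ : ℝ → ℝ} (hF : Integrable F muI) (hφ : Continuous φ)
    (hc : HasCompactSupport φ) : Integrable (fun x => F x * φ x) muI := by
  obtain ⟨C, hC⟩ := hc.exists_bound_of_continuous hφ
  exact hF.mul_bdd hφ.aestronglyMeasurable (Filter.Eventually.of_forall hC)

theorem HasWeakDeriv.congr {F F' v v' : ℝ → ℝ} (h : HasWeakDeriv F v) (hF : F =ᵐ[muI] F')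
    (hv : v =ᵐ[muI] v') : HasWeakDeriv F' v' := by
  refine ⟨h.1.congr hF, h.2.1.congr hv, fun φ h1 h2 h3 => ?_⟩
  have e1 : ∫ x, F' x * deriv φ x ∂muI = ∫ x, F x * deriv φ x ∂muI := integral_congr_ae <| by
    filter_upwards [hF] with x hx
    rw [hx]
  have e2 : ∫ x, v' x * φ x ∂muI = ∫ x, v x * φ x ∂muI := integral_congr_ae <| by
    filter_upwards [hv] with x hx
    rw [hx]
  rw [e1, e2, h.2.2 φ h1 h2 h3]

theorem ae_eq_of_integral_mul_test {F G : ℝ → ℝ} (hF : Integrable F muI) (hG : Integrable G muI)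
    (h : ∀ φ : ℝ → ℝ, ContDiff ℝ ∞ φ → HasCompactSupport φ → tsupport φ ⊆ Ioo (-1) 1 →
      ∫ x, F x * φ x ∂muI = ∫ x, G x * φ x ∂muI) : F =ᵐ[muI] G := by
  have h0 := ae_eq_zero_of_integral_test_eq_zero (hF.sub hG) fun φ h1 h2 h3 => by
    have e : ∀ x, φ x * (F - G) x = F x * φ x - G x * φ x := fun x => by
      rw [Pi.sub_apply]
      ring
    simp only [e]
    rw [integral_sub (integrable_mul_test hF h1.continuous h2)
      (integrable_mul_test hG h1.continuous h2), h φ h1 h2 h3, sub_self]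
  filter_upwards [h0] with x hx using sub_eq_zero.1 hx

theorem HasWeakDeriv.unique {F v v' : ℝ → ℝ} (h : HasWeakDeriv F v) (h' : HasWeakDeriv F v') :
    v =ᵐ[muI] v' :=
  ae_eq_of_integral_mul_test h.2.1 h'.2.1 fun φ h1 h2 h3 =>
    neg_injective ((h.2.2 φ h1 h2 h3).symm.trans (h'.2.2 φ h1 h2 h3))

theorem HasWeakDeriv.add {F G v w : ℝ → ℝ} (hF : HasWeakDeriv F v) (hG : HasWeakDeriv G w) :
    HasWeakDeriv (fun x => F x + G x) fun x => v x + w x := by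
  refine ⟨hF.1.add hG.1, hF.2.1.add hG.2.1, fun φ h1 h2 h3 => ?_⟩
  have h1' : Continuous (deriv φ) := h1.continuous_deriv (by simp)
  simp only [add_mul]
  rw [integral_add (integrable_mul_test hF.1 h1' h2.deriv)
    (integrable_mul_test hG.1 h1' h2.deriv),
    integral_add (integrable_mul_test hF.2.1 h1.continuous h2)
      (integrable_mul_test hG.2.1 h1.continuous h2), hF.2.2 φ h1 h2 h3, hG.2.2 φ h1 h2 h3]
  ring

theorem HasWeakDeriv.const_mul {F v : ℝ → ℝ} (hF : HasWeakDeriv F v) (c : ℝ) :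
    HasWeakDeriv (fun x => c * F x) fun x => c * v x := by
  refine ⟨hF.1.const_mul c, hF.2.1.const_mul c, fun φ h1 h2 h3 => ?_⟩
  simp only [mul_assoc]
  rw [integral_const_mul, integral_const_mul, hF.2.2 φ h1 h2 h3]
  ring

theorem intMinus_one_deriv {φ : ℝ → ℝ} (h1 : ContDiff ℝ ∞ φ) (h3 : tsupport φ ⊆ Ioo (-1) 1)
    (x : ℝ) : intMinus 1 (deriv φ) x = -φ x := by
  have h1' : Continuous (deriv φ) := h1.continuous_deriv (by simp)
  have h0 : φ 1 = 0 := image_eq_zero_of_notMem_tsupport fun h => lt_irrefl _ (h3 h).2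
  rw [intMinus_order_one, intervalIntegral.integral_deriv_eq_sub
    (fun y _ => (h1.differentiable (by simp)).differentiableAt) (h1'.intervalIntegrable _ _), h0,
    zero_sub]

/-- Fractional integration by parts of order one, with `I₋^1 φ' = -φ` for test functions. -/
theorem hasWeakDeriv_intPlus_one {v : ℝ → ℝ} (hv : Integrable v muI) :
    HasWeakDeriv (intPlus 1 v) v := by
  refine ⟨integrable_intPlus zero_le_one hv, hv, fun φ h1 h2 h3 => ?_⟩
  have h1' : Continuous (deriv φ) := h1.continuous_deriv (by simp)
  obtain ⟨C, hC⟩ := h2.deriv.exists_bound_of_continuous h1'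
  have h := integral_mul_intPlus one_pos h1'.aestronglyMeasurable (fun x _ => hC x) hv
  simp only [intMinus_one_deriv h1 h3, neg_mul, integral_neg] at h
  simpa only [mul_comm] using h

theorem hasWeakDeriv_const (c : ℝ) : HasWeakDeriv (fun _ => c) fun _ => 0 := by
  refine ⟨integrable_const _, integrable_zero _ _ _, fun φ h1 h2 h3 => ?_⟩
  have h0 : φ (-1) = 0 := image_eq_zero_of_notMem_tsupport fun h => lt_irrefl _ (h3 h).1
  have h := intMinus_one_deriv h1 h3 (-1)
  rw [intMinus_order_one, h0, intervalIntegral.integral_of_le (by norm_num),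
    ← integral_Icc_eq_integral_Ioc] at h
  simp [integral_const_mul, h]

theorem HasWeakDeriv.comp_neg {F v : ℝ → ℝ} (h : HasWeakDeriv F v) :
    HasWeakDeriv (fun x => F (-x)) fun x => -v (-x) := by
  refine ⟨integrable_comp_neg_muI h.1, (integrable_comp_neg_muI h.2.1).neg,
    fun φ h1 h2 h3 => ?_⟩
  have hs : tsupport (fun x => φ (-x)) ⊆ Ioo (-1) 1 := by
    have : tsupport (fun x => φ (-x)) = (Homeomorph.neg ℝ) ⁻¹' tsupport φ :=
      tsupport_comp_eq_preimage φ (Homeomorph.neg ℝ)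
    rw [this]
    intro x hx
    have := h3 hx
    simp only [Homeomorph.coe_neg, mem_Ioo] at this
    exact ⟨by linarith [this.2], by linarith [this.1]⟩
  have e := h.2.2 (fun x => φ (-x)) (h1.comp contDiff_neg) (h2.comp_homeomorph (Homeomorph.neg ℝ))
    hs
  rw [← integral_comp_neg_muI, ← integral_comp_neg_muI (fun x => v x * φ (-x))] at e
  have hd : ∀ x, deriv (fun x => φ (-x)) (-x) = -deriv φ x := fun x => by
    rw [deriv_comp_neg, neg_neg]
  simp only [hd, neg_neg, mul_neg, integral_neg, neg_mul] at e ⊢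
  linarith

/-! ### Fractional derivatives -/

theorem HasCaputoPlus.congr {α : ℝ} {f f' u : ℝ → ℝ} (h : HasCaputoPlus α f u)
    (hf : f =ᵐ[muI] f') : HasCaputoPlus α f' u :=
  let ⟨v, h1, h2⟩ := h
  ⟨v, h1.congr hf (ae_eq_refl _), h2⟩

theorem HasCaputoPlus.congr_right {α : ℝ} {f u u' : ℝ → ℝ} (h : HasCaputoPlus α f u)
    (hu : u =ᵐ[muI] u') : HasCaputoPlus α f u' :=
  let ⟨v, h1, h2⟩ := h
  ⟨v, h1, h2.congr (ae_eq_refl _) hu⟩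

theorem HasCaputoPlus.unique {α : ℝ} (hα : α ≤ 2) {f u u' : ℝ → ℝ} (h : HasCaputoPlus α f u)
    (h' : HasCaputoPlus α f u') : u =ᵐ[muI] u' := by
  obtain ⟨v, h1, h2⟩ := h
  obtain ⟨v', h1', h2'⟩ := h'
  exact (h2.congr (intPlus_ae_congr (sub_nonneg.2 hα) (h1.unique h1')) (ae_eq_refl _)).unique h2'

theorem HasCaputoPlus.add {α : ℝ} (hα : α ≤ 2) {f g u w : ℝ → ℝ} (hf : HasCaputoPlus α f u)
    (hg : HasCaputoPlus α g w) : HasCaputoPlus α (fun x => f x + g x) fun x => u x + w x := by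
  obtain ⟨v, h1, h2⟩ := hf
  obtain ⟨v', h1', h2'⟩ := hg
  exact ⟨_, h1.add h1', (h2.add h2').congr
    (intPlus_ae_add (sub_nonneg.2 hα) h1.2.1 h1'.2.1).symm (ae_eq_refl _)⟩

theorem HasCaputoPlus.const_mul {α : ℝ} {f u : ℝ → ℝ} (hf : HasCaputoPlus α f u) (c : ℝ) :
    HasCaputoPlus α (fun x => c * f x) fun x => c * u x := by
  obtain ⟨v, h1, h2⟩ := hf
  exact ⟨_, h1.const_mul c, (h2.const_mul c).congr
    (Filter.Eventually.of_forall fun x => (intPlus_const_mul c v x).symm) (ae_eq_refl _)⟩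

/-- `D I^α g = I^{α-1} g` and `I^{2-α} I^{α-1} g = I^1 g`. The case `α = 2` is separate because
order `0` is the identity by definition and not a kernel operator. -/
theorem hasCaputoPlus_intPlus {α : ℝ} (hα1 : 1 < α) (hα2 : α ≤ 2) {g : ℝ → ℝ}
    (hg : Integrable g muI) : HasCaputoPlus α (intPlus α g) g := by
  have h1 : Integrable (intPlus (α - 1) g) muI := integrable_intPlus (by linarith) hg
  refine ⟨intPlus (α - 1) g, (hasWeakDeriv_intPlus_one h1).congr ?_ (ae_eq_refl _),
    (hasWeakDeriv_intPlus_one hg).congr ?_ (ae_eq_refl _)⟩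
  · filter_upwards [ae_mem_Icc] with x hx using intPlus_one_intPlus hα1 hg hx
  · rcases hα2.eq_or_lt with rfl | hα2
    · rw [sub_self, intPlus_zero_order]
      norm_num
    · filter_upwards [ae_mem_Icc] with x hx
      rw [intPlus_intPlus (by linarith) (by linarith) (by linarith) hg hx]
      norm_num

/-- `D p_{α-1} = p_{α-2}` is integrable as `α > 1`, and `I^{2-α} p_{α-2} = p_0` is constant. -/
theorem hasCaputoPlus_pPlus {α : ℝ} (hα1 : 1 < α) (hα2 : α ≤ 2) :
    HasCaputoPlus α (pPlus (α - 1)) fun _ => 0 := by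
  have h1 : Integrable (pPlus (α - 2)) muI := integrable_pPlus (by linarith)
  refine ⟨pPlus (α - 2), (hasWeakDeriv_intPlus_one h1).congr ?_ (ae_eq_refl _),
    (hasWeakDeriv_const 1).congr ?_ (ae_eq_refl _)⟩
  · filter_upwards [ae_mem_Icc] with x hx
    rw [intPlus_pPlus one_pos (by linarith) (by linarith) hx]
    ring_nf
  · filter_upwards [intPlus_pPlus_ae (sub_nonneg.2 hα2) (show -1 < α - 2 by linarith)] with x hx
    rw [hx, show 2 - α + (α - 2) = 0 by ring, pPlus_zero]

theorem hasCaputoPlus_const {α : ℝ} (c : ℝ) : HasCaputoPlus α (fun _ => c) fun _ => 0 := by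
  refine ⟨fun _ => 0, hasWeakDeriv_const c, (hasWeakDeriv_const 0).congr ?_ (ae_eq_refl _)⟩
  refine Filter.Eventually.of_forall fun x => ?_
  simpa using (intPlus_const_mul (ν := 2 - α) 0 (fun _ => 0) x).symm

/-- Each of the two derivatives changes sign under reflection, and the signs cancel. -/
theorem hasCaputoMinus_iff {α : ℝ} {f u : ℝ → ℝ} :
    HasCaputoMinus α f u ↔ HasCaputoPlus α (fun x => f (-x)) fun x => u (-x) := by
  constructor
  · rintro ⟨v, h1, h2⟩
    refine ⟨fun x => -v (-x), h1.comp_neg, ?_⟩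
    refine (h2.comp_neg.const_mul (-1)).congr (Filter.Eventually.of_forall fun x => ?_)
      (Filter.Eventually.of_forall fun x => by simp)
    have h := intPlus_const_mul (ν := 2 - α) (-1) (fun s => v (-s)) x
    simp only [neg_one_mul] at h
    simp only [intMinus_eq_intPlus_neg, neg_neg, neg_one_mul, h]
  · rintro ⟨v, h1, h2⟩
    refine ⟨fun x => -v (-x), by simpa using h1.comp_neg, ?_⟩
    refine (h2.comp_neg.const_mul (-1)).congr (Filter.Eventually.of_forall fun x => ?_)
      (Filter.Eventually.of_forall fun x => by simp)
    have h := intPlus_const_mul (ν := 2 - α) (-1) v (-x)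
    simp only [neg_one_mul] at h
    simp only [intMinus_eq_intPlus_neg, neg_neg, neg_one_mul, h]

theorem HasRLPlus.congr {α : ℝ} (hα : α ≤ 2) {f f' u : ℝ → ℝ} (h : HasRLPlus α f u)
    (hf : f =ᵐ[muI] f') : HasRLPlus α f' u :=
  let ⟨w, h1, h2⟩ := h
  ⟨w, h1.congr (intPlus_ae_congr (sub_nonneg.2 hα) hf) (ae_eq_refl _), h2⟩

theorem HasRLPlus.unique {α : ℝ} {f u u' : ℝ → ℝ} (h : HasRLPlus α f u)
    (h' : HasRLPlus α f u') : u =ᵐ[muI] u' := by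
  obtain ⟨w, h1, h2⟩ := h
  obtain ⟨w', h1', h2'⟩ := h'
  exact (h2.congr (h1.unique h1') (ae_eq_refl _)).unique h2'

/-- `D₊^α (I₊^α g + c p_{α-2}) = g`. -/
theorem hasRLPlus_intPlus_add {α : ℝ} (hα1 : 1 < α) (hα2 : α ≤ 2) {g : ℝ → ℝ}
    (hg : Integrable g muI) (c : ℝ) :
    HasRLPlus α (fun x => intPlus α g x + c * pPlus (α - 2) x) g := by
  have h0 : 0 ≤ 2 - α := sub_nonneg.2 hα2
  have hp : Integrable (pPlus (α - 2)) muI := integrable_pPlus (by linarith)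
  have h1 := integrable_intPlus zero_le_one hg
  -- `I^{2-α} (I^α g + c p_{α-2}) = I^2 g + c`, so the first derivative is `I^1 g`.
  refine ⟨intPlus 1 g, ?_, hasWeakDeriv_intPlus_one hg⟩
  have h2 := (hasWeakDeriv_intPlus_one h1).add (hasWeakDeriv_const c)
  refine h2.congr ?_ (Filter.Eventually.of_forall fun x => by simp)
  have h3 : intPlus (2 - α) (intPlus α g) =ᵐ[muI] intPlus 1 (intPlus 1 g) := by
    filter_upwards [ae_mem_Icc] with x hx
    rw [intPlus_intPlus one_pos one_pos (by norm_num) hg hx]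
    rcases hα2.eq_or_lt with rfl | hα2
    · rw [sub_self, intPlus_zero_order]
      norm_num
    · rw [intPlus_intPlus (by linarith) (by linarith) (by linarith) hg hx]
      norm_num
  filter_upwards [h3, intPlus_ae_add h0 (integrable_intPlus (by linarith) hg) (hp.const_mul c),
    intPlus_pPlus_ae h0 (show -1 < α - 2 by linarith)] with x e1 e2 e3
  rw [e2, e1, intPlus_const_mul, e3, show 2 - α + (α - 2) = 0 by ring, pPlus_zero, mul_one]

/-- `∂₊^α (I₊^α g + c p_{α-1}) = g`. -/
theorem hasCaputoPlus_intPlus_add {α : ℝ} (hα1 : 1 < α) (hα2 : α ≤ 2) {g : ℝ → ℝ}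
    (hg : Integrable g muI) (c : ℝ) :
    HasCaputoPlus α (fun x => intPlus α g x + c * pPlus (α - 1) x) g := by
  refine ((hasCaputoPlus_intPlus hα1 hα2 hg).add hα2
    ((hasCaputoPlus_pPlus hα1 hα2).const_mul c)).congr_right ?_
  exact Filter.Eventually.of_forall fun x => by simp

/-- `∂₊^α (I₊^α g + c) = g`. -/
theorem hasCaputoPlus_intPlus_add_const {α : ℝ} (hα1 : 1 < α) (hα2 : α ≤ 2) {g : ℝ → ℝ}
    (hg : Integrable g muI) (c : ℝ) :
    HasCaputoPlus α (fun x => intPlus α g x + c * pPlus 0 x) g := by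
  refine (((hasCaputoPlus_intPlus hα1 hα2 hg).add hα2
    (hasCaputoPlus_const c)).congr_right ?_).congr ?_
  · exact Filter.Eventually.of_forall fun x => by simp
  · exact Filter.Eventually.of_forall fun x => by simp [pPlus_zero]

theorem HasCaputoMinus.congr {α : ℝ} {f f' u : ℝ → ℝ} (h : HasCaputoMinus α f u)
    (hf : f =ᵐ[muI] f') : HasCaputoMinus α f' u :=
  hasCaputoMinus_iff.2 ((hasCaputoMinus_iff.1 h).congr (ae_eq_comp_neg_muI hf))

theorem HasCaputoMinus.unique {α : ℝ} (hα : α ≤ 2) {f u u' : ℝ → ℝ} (h : HasCaputoMinus α f u)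
    (h' : HasCaputoMinus α f u') : u =ᵐ[muI] u' := by
  have e := ae_eq_comp_neg_muI ((hasCaputoMinus_iff.1 h).unique hα (hasCaputoMinus_iff.1 h'))
  simpa using e

/-- `∂₋^α (I₋^α g + c p_{α-1}) = g`. -/
theorem hasCaputoMinus_intMinus_add {α : ℝ} (hα1 : 1 < α) (hα2 : α ≤ 2) {g : ℝ → ℝ}
    (hg : Integrable g muI) (c : ℝ) :
    HasCaputoMinus α (fun x => intMinus α g x + c * pMinus (α - 1) x) g := by
  rw [hasCaputoMinus_iff]
  simpa only [intMinus_eq_intPlus_neg, pMinus_eq_pPlus_neg, neg_neg] using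
    hasCaputoPlus_intPlus_add hα1 hα2 (integrable_comp_neg_muI hg) c

/-- `∂₋^α (I₋^α g + c) = g`. -/
theorem hasCaputoMinus_intMinus_add_const {α : ℝ} (hα1 : 1 < α) (hα2 : α ≤ 2) {g : ℝ → ℝ}
    (hg : Integrable g muI) (c : ℝ) :
    HasCaputoMinus α (fun x => intMinus α g x + c * pMinus 0 x) g := by
  rw [hasCaputoMinus_iff]
  simpa only [intMinus_eq_intPlus_neg, pMinus_eq_pPlus_neg, neg_neg] using
    hasCaputoPlus_intPlus_add_const hα1 hα2 (integrable_comp_neg_muI hg) c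

/-! ### The spaces `C₀(Ω)` and `L₁[-1,1]` -/

theorem Omega_subset_Icc (i : Pair) : i.Omega ⊆ Icc (-1) 1 := by
  cases i
  exacts [Ioo_subset_Icc_self, Ioc_subset_Icc_self, Ico_subset_Icc_self, subset_rfl,
    Ico_subset_Icc_self, subset_rfl]

theorem Ioo_subset_Omega (i : Pair) : Ioo (-1) 1 ⊆ i.Omega := by
  cases i
  exacts [subset_rfl, Ioo_subset_Ioc_self, Ioo_subset_Ico_self, Ioo_subset_Icc_self,
    Ioo_subset_Ico_self, Ioo_subset_Icc_self]

theorem ae_mem_Omega (i : Pair) : ∀ᵐ x ∂muI, x ∈ i.Omega :=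
  ae_mem_Ioo.mono fun _ hx => Ioo_subset_Omega i hx

/-- Passes from the almost everywhere identities produced by pairings to the pointwise ones in the
domains of the backward operators. -/
theorem eqOn_Omega_of_ae_eq {i : Pair} {F G : ℝ → ℝ} (hF : ContinuousOn F i.Omega)
    (hG : ContinuousOn G i.Omega) (h : F =ᵐ[muI] G) : EqOn F G i.Omega := by
  refine Measure.eqOn_of_ae_eq (μ := volume)
    (ae_restrict_of_ae_restrict_of_subset (Omega_subset_Icc i) h) hF hG ?_
  calc i.Omega ⊆ Icc (-1) 1 := Omega_subset_Icc i
    _ = closure (Ioo (-1) 1) := (closure_Ioo (by norm_num)).symm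
    _ ⊆ closure (interior i.Omega) :=
      closure_mono (interior_maximal (Ioo_subset_Omega i) isOpen_Ioo)

theorem continuousOn_ext {i : Pair} (φ : C0 i) : ContinuousOn (ext φ) i.Omega := by
  rw [continuousOn_iff_continuous_domRestrict]
  convert φ.continuous using 1
  funext x
  exact ext_apply φ x

theorem integrable_ext {i : Pair} (φ : C0 i) : Integrable (ext φ) muI :=
  Integrable.of_bound (measurable_ext φ).aestronglyMeasurable ‖φ‖
    (Filter.Eventually.of_forall (norm_ext_le φ))

theorem ext_ae_eq {i : Pair} {φ : C0 i} {F : ℝ → ℝ} (h : ∀ x : i.Omega, φ x = F x) :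
    ext φ =ᵐ[muI] F := by
  filter_upwards [ae_mem_Omega i] with x hx
  rw [ext_apply φ ⟨x, hx⟩, h]

theorem apply_eq_of_ext_ae_eq {i : Pair} {φ : C0 i} {F : ℝ → ℝ}
    (hF : ContinuousOn F (Icc (-1) 1)) (h : ext φ =ᵐ[muI] F) (x : i.Omega) : φ x = F x := by
  rw [← ext_apply φ x]
  exact eqOn_Omega_of_ae_eq (continuousOn_ext φ) (hF.mono (Omega_subset_Icc i)) h x.2

theorem eq_of_ext_ae_eq {i : Pair} {φ ψ : C0 i} (h : ext φ =ᵐ[muI] ext ψ) : φ = ψ := by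
  refine ZeroAtInftyContinuousMap.ext fun x => ?_
  rw [← ext_apply φ x, ← ext_apply ψ x]
  exact eqOn_Omega_of_ae_eq (continuousOn_ext φ) (continuousOn_ext ψ) h x.2

/-- The sets `{|F| ≥ ε}` are compact in `[-1, 1]` and avoid the removed endpoints, hence are compact
in `Ω`. -/
theorem exists_C0_eq (i : Pair) {F : ℝ → ℝ} (hF : ContinuousOn F (Icc (-1) 1))
    (h0 : ∀ x ∈ Icc (-1 : ℝ) 1, x ∉ i.Omega → F x = 0) :
    ∃ φ : C0 i, ∀ x : i.Omega, φ x = F x := by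
  refine ⟨⟨⟨fun x => F x, (hF.mono (Omega_subset_Icc i)).domRestrict⟩, ?_⟩, fun x => rfl⟩
  rw [Metric.tendsto_nhds]
  intro ε hε
  have hS : IsCompact (Icc (-1) 1 ∩ F ⁻¹' {y | ε ≤ dist y 0}) :=
    isCompact_Icc.of_isClosed_subset (hF.preimage_isClosed_of_isClosed isClosed_Icc
      (isClosed_le continuous_const (continuous_id.dist continuous_const))) inter_subset_left
  refine Filter.mem_cocompact.2 ⟨Subtype.val ⁻¹' (Icc (-1) 1 ∩ F ⁻¹' {y | ε ≤ dist y 0}), ?_, ?_⟩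
  · rw [Subtype.isCompact_iff, Subtype.image_preimage_coe, inter_eq_right.2]
    · exact hS
    · rintro x ⟨hx, hx'⟩
      by_contra h
      simp only [mem_preimage, mem_ofPred_eq, h0 x hx h, dist_self] at hx'
      exact hε.not_ge hx'
  · intro x hx
    by_contra h
    exact hx ⟨Omega_subset_Icc i x.2, show ε ≤ dist (F x) 0 from not_lt.1 h⟩

theorem integrable_continuousOn_mul {b g : ℝ → ℝ} (hb : ContinuousOn b (Icc (-1) 1))
    (hg : Integrable g muI) : Integrable (fun x => b x * g x) muI :=
  IntegrableOn.continuousOn_mul hb hg isCompact_Icc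

theorem integrable_continuousOn {b : ℝ → ℝ} (hb : ContinuousOn b (Icc (-1) 1)) :
    Integrable b muI := hb.integrableOn_Icc

theorem integrable_ext_mul' {i : Pair} (φ : C0 i) {f : ℝ → ℝ} (hf : Integrable f muI) :
    Integrable (fun x => ext φ x * f x) muI :=
  hf.bdd_mul (measurable_ext φ).aestronglyMeasurable (Filter.Eventually.of_forall (norm_ext_le φ))

theorem integral_mul_congr {f f' g g' : ℝ → ℝ} (hf : f =ᵐ[muI] f') (hg : g =ᵐ[muI] g') :
    ∫ x, f x * g x ∂muI = ∫ x, f' x * g' x ∂muI := by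
  refine integral_congr_ae ?_
  filter_upwards [hf, hg] with x h1 h2
  rw [h1, h2]

/-- `C₀(Ω)` separates the points of `L₁[-1,1]`. -/
theorem ae_eq_of_integral_ext_mul (i : Pair) {f g : ℝ → ℝ} (hf : Integrable f muI)
    (hg : Integrable g muI)
    (h : ∀ ψ : C0 i, ∫ x, ext ψ x * f x ∂muI = ∫ x, ext ψ x * g x ∂muI) : f =ᵐ[muI] g := by
  refine ae_eq_of_integral_mul_test hf hg fun φ h1 _ h3 => ?_
  obtain ⟨ψ, hψ⟩ := exists_C0_eq i h1.continuous.continuousOn fun x _ hx =>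
    image_eq_zero_of_notMem_tsupport fun h => hx (Ioo_subset_Omega i (h3 h))
  have e := h ψ
  rw [integral_mul_congr (ext_ae_eq hψ) (ae_eq_refl f),
    integral_mul_congr (ext_ae_eq hψ) (ae_eq_refl g)] at e
  simpa only [mul_comm] using e

theorem integral_ext_mul_intPlus {α : ℝ} (hα : 0 < α) {i : Pair} (ψ : C0 i) {g : ℝ → ℝ}
    (hg : Integrable g muI) :
    ∫ x, ext ψ x * intPlus α g x ∂muI = ∫ x, intMinus α (ext ψ) x * g x ∂muI :=
  integral_mul_intPlus hα (measurable_ext ψ).aestronglyMeasurable (fun x _ => norm_ext_le ψ x) hg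

/-! ### Adjoints of operators with an inverse that differs from `I^α` by an operator of rank one -/

/-- Transposition exchanges `I₊^α` with `I₋^α`, and `a` with `b` in the rank one term. -/
theorem integral_ext_mul_rankOne {α : ℝ} (hα : 1 < α) {i : Pair} {a b g : ℝ → ℝ}
    (ha : Integrable a muI) (hb : ContinuousOn b (Icc (-1) 1)) (ψ : C0 i)
    (hg : Integrable g muI) :
    ∫ x, ext ψ x * (intPlus α g x - (∫ s, b s * g s ∂muI) * a x) ∂muI =
      ∫ x, (intMinus α (ext ψ) x - (∫ s, ext ψ s * a s ∂muI) * b x) * g x ∂muI := by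
  have h1 := integrable_ext_mul' ψ (integrable_intPlus (ν := α) (by linarith) hg)
  have h2 := integrable_continuousOn_mul (continuousOn_intMinus hα (integrable_ext ψ)) hg
  simp only [mul_sub, sub_mul, mul_left_comm (ext ψ _), mul_assoc]
  rw [integral_sub h1 ((integrable_ext_mul' ψ ha).const_mul _),
    integral_sub h2 ((integrable_continuousOn_mul hb hg).const_mul _),
    integral_const_mul, integral_const_mul, integral_ext_mul_intPlus (by linarith) ψ hg]
  ring

theorem mem_partIn_adjoint_opPlus {α : ℝ} {i : Pair} {φ ψ : C0 i} :
    (φ, ψ) ∈ partIn (pairing i) (adjoint (opPlus α i)) ↔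
      ∀ f g : L1I, (f, g) ∈ opPlus α i →
        ∫ x, ext φ x * g x ∂muI = ∫ x, ext ψ x * f x ∂muI :=
  ⟨fun h f g hfg => h (f, g) hfg, fun h p hp => h p.1 p.2 hp⟩

theorem mem_partIn_adjoint_opMinus {α : ℝ} {i : Pair} {f g : L1I} :
    (f, g) ∈ partIn (pairing i).flip (adjoint (opMinus α i)) ↔
      ∀ φ ψ : C0 i, (φ, ψ) ∈ opMinus α i →
        ∫ x, ext ψ x * f x ∂muI = ∫ x, ext φ x * g x ∂muI :=
  ⟨fun h φ ψ hp => h (φ, ψ) hp, fun h p hp => h p.1 p.2 hp⟩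

/-- Both operators are inverses of maps `R` and `R'` with `⟨ψ, R g⟩ = ⟨R' ψ, g⟩`. If `⟨φ, g⟩ = ⟨ψ, R
g⟩` for enough `g`, then `φ = R' ψ`, and symmetrically. The hypothesis `h0` puts `R' ψ` into `C₀(Ω)`
for every `ψ`, so that `A⁻` is surjective. -/
theorem adjoint_rankOne {α : ℝ} (hα : 1 < α) (i : Pair) {a b : ℝ → ℝ}
    (ha : Integrable a muI) (hb : ContinuousOn b (Icc (-1) 1))
    (hplus : ∀ f g : L1I, (f, g) ∈ opPlus α i ↔
      f =ᵐ[muI] fun x => intPlus α g x - (∫ s, b s * g s ∂muI) * a x)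
    (hminus : ∀ φ ψ : C0 i, (φ, ψ) ∈ opMinus α i ↔
      ∀ x : i.Omega, φ x = intMinus α (ext ψ) x - (∫ s, ext ψ s * a s ∂muI) * b x)
    (h0 : ∀ ψ : C0 i, ∀ x ∈ Icc (-1 : ℝ) 1, x ∉ i.Omega →
      intMinus α (ext ψ) x - (∫ s, ext ψ s * a s ∂muI) * b x = 0) :
    opMinus α i = partIn (pairing i) (adjoint (opPlus α i)) ∧
      opPlus α i = partIn (pairing i).flip (adjoint (opMinus α i)) := by
  have hcont : ∀ ψ : C0 i, ContinuousOn
      (fun x => intMinus α (ext ψ) x - (∫ s, ext ψ s * a s ∂muI) * b x) (Icc (-1) 1) := fun ψ =>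
    (continuousOn_intMinus hα (integrable_ext ψ)).sub (continuousOn_const.mul hb)
  have hint : ∀ g : ℝ → ℝ, Integrable g muI → Integrable
      (fun x => intPlus α g x - (∫ s, b s * g s ∂muI) * a x) muI := fun g hg =>
    (integrable_intPlus (by linarith) hg).sub (ha.const_mul _)
  have hdual : ∀ (f g : L1I) (φ ψ : C0 i), (f, g) ∈ opPlus α i → (φ, ψ) ∈ opMinus α i →
      ∫ x, ext φ x * g x ∂muI = ∫ x, ext ψ x * f x ∂muI := by
    intro f g φ ψ hfg hp
    rw [integral_mul_congr (ae_eq_refl (ext ψ)) ((hplus f g).1 hfg),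
      integral_mul_congr (ext_ae_eq (F := fun x => _ - _ * b x) ((hminus φ ψ).1 hp))
        (ae_eq_refl g), integral_ext_mul_rankOne hα ha hb ψ (L1.integrable_coeFn g)]
  constructor
  · ext ⟨φ, ψ⟩
    rw [mem_partIn_adjoint_opPlus]
    refine ⟨fun hp f g hfg => hdual f g φ ψ hfg hp, fun h => (hminus φ ψ).2 ?_⟩
    refine apply_eq_of_ext_ae_eq (hcont ψ) ?_
    -- It is enough to use the pairs `(R η, η)` with test functions `η`.
    refine ae_eq_of_integral_mul_test (integrable_ext φ) (integrable_continuousOn (hcont ψ))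
      fun η h1 h2 _ => ?_
    have hη : Integrable η muI := (h1.continuous.integrable_of_hasCompactSupport h2).integrableOn
    have e := h (hint _ (L1.integrable_coeFn (hη.toL1 η))).toL1 (hη.toL1 η)
      ((hplus _ _).2 (Integrable.coeFn_toL1 _))
    rwa [integral_mul_congr (ae_eq_refl (ext ψ)) (Integrable.coeFn_toL1 _),
      integral_ext_mul_rankOne hα ha hb ψ (L1.integrable_coeFn _),
      integral_mul_congr (ae_eq_refl (ext φ)) (Integrable.coeFn_toL1 hη),
      integral_mul_congr (ae_eq_refl _) (Integrable.coeFn_toL1 hη)] at e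
  · ext ⟨f, g⟩
    rw [mem_partIn_adjoint_opMinus]
    refine ⟨fun hfg φ ψ hp => (hdual f g φ ψ hfg hp).symm, fun h => (hplus f g).2 ?_⟩
    refine ae_eq_of_integral_ext_mul i (L1.integrable_coeFn f) (hint _ (L1.integrable_coeFn g))
      fun ψ => ?_
    obtain ⟨φ, hφ⟩ := exists_C0_eq i (hcont ψ) (h0 ψ)
    rw [h φ ψ ((hminus φ ψ).2 hφ),
      integral_mul_congr (ext_ae_eq (F := fun x => _ - _ * b x) hφ) (ae_eq_refl g),
      ← integral_ext_mul_rankOne hα ha hb ψ (L1.integrable_coeFn g)]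

/-! ### Adjoints of operators with a kernel -/

theorem integral_mul_sub_const {F η : ℝ → ℝ} (hF : Integrable F muI)
    (hFη : Integrable (fun x => F x * η x) muI) (t : ℝ) :
    ∫ x, F x * (η x - t) ∂muI = ∫ x, F x * η x ∂muI - t * ∫ x, F x ∂muI := by
  simp only [mul_sub]
  rw [integral_sub hFη (hF.mul_const t), integral_mul_const, mul_comm t]

theorem integral_const_muI (c : ℝ) : ∫ _, c ∂muI = 2 * c := by
  norm_num [Measure.real, Real.volume_Icc]

/-- Elements `(a, 0)` and `(1, 0)` of the graphs give the range conditions of the adjoints. What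
remains is tested only against functions of mean zero, or orthogonal to `a`, and is thus determined
up to a multiple of `1`, or of `a`. As `Ω` is closed, constants belong to `C₀(Ω)`. -/
theorem adjoint_of_kernel {α : ℝ} (hα : 1 < α) (i : Pair) (hi : i.Omega = Icc (-1) 1)
    {a : ℝ → ℝ} (ha : Integrable a muI) (ha0 : ∫ x, a x ∂muI ≠ 0)
    (hplus : ∀ f g : L1I, (f, g) ∈ opPlus α i ↔
      ∫ x, g x ∂muI = 0 ∧ ∃ c : ℝ, f =ᵐ[muI] fun x => intPlus α g x + c * a x)
    (hminus : ∀ φ ψ : C0 i, (φ, ψ) ∈ opMinus α i ↔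
      ∫ x, ext ψ x * a x ∂muI = 0 ∧ ∃ c : ℝ, ∀ x : i.Omega, φ x = intMinus α (ext ψ) x + c) :
    opMinus α i = partIn (pairing i) (adjoint (opPlus α i)) ∧
      opPlus α i = partIn (pairing i).flip (adjoint (opMinus α i)) := by
  have hα0 : 0 < α := by linarith
  have hcont : ∀ ψ : C0 i, ContinuousOn (intMinus α (ext ψ)) (Icc (-1) 1) := fun ψ =>
    continuousOn_intMinus hα (integrable_ext ψ)
  have hint : ∀ {g : ℝ → ℝ}, Integrable g muI → Integrable (intPlus α g) muI := fun hg =>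
    integrable_intPlus hα0.le hg
  have hdual : ∀ (f g : L1I) (φ ψ : C0 i), (f, g) ∈ opPlus α i → (φ, ψ) ∈ opMinus α i →
      ∫ x, ext φ x * g x ∂muI = ∫ x, ext ψ x * f x ∂muI := by
    intro f g φ ψ hfg hp
    obtain ⟨hg0, c, hf⟩ := (hplus f g).1 hfg
    obtain ⟨hψ0, d, hφ⟩ := (hminus φ ψ).1 hp
    have hg := L1.integrable_coeFn g
    rw [integral_mul_congr (ae_eq_refl (ext ψ)) hf,
      integral_mul_congr (ext_ae_eq (F := fun x => intMinus α (ext ψ) x + d) hφ)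
        (ae_eq_refl g)]
    simp only [mul_add, add_mul, mul_left_comm (ext ψ _)]
    rw [integral_add (integrable_continuousOn_mul (hcont ψ) hg) (hg.const_mul d),
      integral_add (integrable_ext_mul' ψ (hint hg)) ((integrable_ext_mul' ψ ha).const_mul c),
      integral_const_mul, integral_const_mul, hg0, hψ0, integral_ext_mul_intPlus hα0 ψ hg]
    ring
  constructor
  · ext ⟨φ, ψ⟩
    rw [mem_partIn_adjoint_opPlus]
    refine ⟨fun hp f g hfg => hdual f g φ ψ hfg hp, fun h => (hminus φ ψ).2 ⟨?_, ?_⟩⟩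
    · have hz := Lp.coeFn_zero ℝ 1 muI
      have e := h (ha.toL1 a) 0 ((hplus _ _).2 ⟨?_, 1, ?_⟩)
      · rw [integral_mul_congr (ae_eq_refl (ext ψ)) (Integrable.coeFn_toL1 ha),
          integral_mul_congr (ae_eq_refl (ext φ)) hz] at e
        simpa using e.symm
      · rw [integral_congr_ae hz]
        simp
      · filter_upwards [Integrable.coeFn_toL1 ha, ae_mem_Icc] with x hx hx'
        have h0 := intPlus_const_mul (ν := α) 0 (fun _ => 0) x
        simp only [zero_mul] at h0
        rw [hx, intPlus_congr hα0 hz hx', one_mul]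
        change _ = intPlus α (fun _ => 0) x + _
        rw [h0, zero_add]
    · have hJ := integrable_continuousOn (hcont ψ)
      -- The constant is forced by integrating `φ = I₋^α ψ + c` over an interval of length `2`.
      refine ⟨(∫ x, ext φ x ∂muI - ∫ x, intMinus α (ext ψ) x ∂muI) / 2, ?_⟩
      set c := (∫ x, ext φ x ∂muI - ∫ x, intMinus α (ext ψ) x ∂muI) / 2 with hc
      refine apply_eq_of_ext_ae_eq ((hcont ψ).add continuousOn_const) ?_
      refine ae_eq_of_integral_mul_test (G := fun x => intMinus α (ext ψ) x + c)
        (integrable_ext φ) (hJ.add (integrable_const c))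
        fun η h1 h2 _ => ?_
      have hη : Integrable η muI :=
        (h1.continuous.integrable_of_hasCompactSupport h2).integrableOn
      -- Subtracting the mean `t` puts `η` into the range of `A⁺`.
      obtain ⟨t, ht⟩ : ∃ t, ∫ x, η x ∂muI = 2 * t := ⟨(∫ x, η x ∂muI) / 2, by ring⟩
      have hk : Integrable (fun x => η x - t) muI := hη.sub (integrable_const t)
      have e := h (hint (L1.integrable_coeFn (hk.toL1 _))).toL1 (hk.toL1 _)
        ((hplus _ _).2 ⟨?_, 0, ?_⟩)
      · rw [integral_mul_congr (ae_eq_refl (ext ψ)) (Integrable.coeFn_toL1 _),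
          integral_ext_mul_intPlus hα0 ψ (L1.integrable_coeFn _),
          integral_mul_congr (ae_eq_refl (ext φ)) (Integrable.coeFn_toL1 hk),
          integral_mul_congr (ae_eq_refl _) (Integrable.coeFn_toL1 hk),
          integral_mul_sub_const (integrable_ext φ) (integrable_ext_mul' φ hη),
          integral_mul_sub_const hJ (integrable_continuousOn_mul (hcont ψ) hη)] at e
        simp only [add_mul]
        rw [integral_add (integrable_continuousOn_mul (hcont ψ) hη) (hη.const_mul c),
          integral_const_mul, ht, hc]
        linear_combination e
      · rw [integral_congr_ae (Integrable.coeFn_toL1 hk), integral_sub hη (integrable_const t),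
          ht, integral_const_muI, sub_self]
      · filter_upwards [Integrable.coeFn_toL1 (hint (L1.integrable_coeFn (hk.toL1 _)))] with x hx
        rw [hx]
        simp
  · ext ⟨f, g⟩
    rw [mem_partIn_adjoint_opMinus]
    refine ⟨fun hfg φ ψ hp => (hdual f g φ ψ hfg hp).symm, fun h => (hplus f g).2 ⟨?_, ?_⟩⟩
    · obtain ⟨φ, hφ⟩ := exists_C0_eq i (F := fun _ => 1) continuousOn_const
        fun x hx hx' => absurd hx (hi ▸ hx')
      have hz : ∀ x, ext (0 : C0 i) x = 0 := fun x => by simpa using ext_smul 0 (0 : C0 i) x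
      have h0 : ∀ x, intMinus α (ext (0 : C0 i)) x = 0 := fun x => by
        rw [show ext (0 : C0 i) = fun _ => 0 from funext hz]
        simpa using intMinus_const_mul (ν := α) 0 (fun _ => 0) x
      have e := h φ 0 ((hminus _ _).2 ⟨by simp [hz], 1, fun x => by rw [hφ, h0, zero_add]⟩)
      rw [integral_mul_congr (ext_ae_eq (F := fun _ => 1) hφ) (ae_eq_refl g)] at e
      simpa [hz] using e.symm
    · have hf := L1.integrable_coeFn f
      have hg := L1.integrable_coeFn g
      have hr : Integrable (fun x => f x - intPlus α g x) muI := hf.sub (hint hg)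
      -- The coefficient is forced by integrating `f - I₊^α g = c a`; here `∫ a ≠ 0` is needed.
      refine ⟨(∫ x, f x - intPlus α g x ∂muI) / ∫ x, a x ∂muI, ?_⟩
      set c := (∫ x, f x - intPlus α g x ∂muI) / ∫ x, a x ∂muI with hc
      refine ae_eq_of_integral_ext_mul i hf ((hint hg).add (ha.const_mul c)) fun ψ => ?_
      -- With this `t`, the function `χ = ψ - t` is orthogonal to `a`, so `(I₋^α χ, χ)` lies in the
      -- graph of `A⁻`.
      obtain ⟨t, ht⟩ : ∃ t, ∫ x, ext ψ x * a x ∂muI = t * ∫ x, a x ∂muI :=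
        ⟨(∫ x, ext ψ x * a x ∂muI) / ∫ x, a x ∂muI, by field_simp⟩
      obtain ⟨χ, hχ⟩ := exists_C0_eq i (F := fun x => ext ψ x - t)
        ((hi ▸ continuousOn_ext ψ).sub continuousOn_const) fun x hx hx' => absurd hx (hi ▸ hx')
      obtain ⟨φ, hφ⟩ := exists_C0_eq i (F := fun x => intMinus α (ext χ) x + 0)
        ((hcont χ).add continuousOn_const) fun x hx hx' => absurd hx (hi ▸ hx')
      have hχ' := ext_ae_eq (F := fun x => ext ψ x - t) hχ
      have hmul : ∀ {k : ℝ → ℝ}, Integrable k muI → ∫ x, ext χ x * k x ∂muI =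
          ∫ x, ext ψ x * k x ∂muI - t * ∫ x, k x ∂muI := by
        intro k hk
        rw [integral_mul_congr hχ' (ae_eq_refl k)]
        simpa only [mul_comm] using integral_mul_sub_const (F := k) (η := ext ψ) hk
          (by simpa only [mul_comm] using integrable_ext_mul' ψ hk) t
      have e := h φ χ ((hminus _ _).2 ⟨by rw [hmul ha, ht, sub_self], 0, hφ⟩)
      rw [integral_mul_congr (ext_ae_eq (F := fun x => intMinus α (ext χ) x + 0) hφ)
        (ae_eq_refl g)] at e
      simp only [add_zero] at e
      rw [← integral_ext_mul_intPlus hα0 χ hg, hmul hf, hmul (hint hg)] at e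
      have hc' : c * ∫ x, a x ∂muI = ∫ x, f x ∂muI - ∫ x, intPlus α g x ∂muI := by
        rw [hc, div_mul_cancel₀ _ ha0, integral_sub hf (hint hg)]
      simp only [mul_add, mul_left_comm (ext ψ _)]
      rw [integral_add (integrable_ext_mul' ψ (hint hg)) ((integrable_ext_mul' ψ ha).const_mul c),
        integral_const_mul, ht]
      linear_combination e - t * hc'

/-! ### The graphs of the six pairs of operators -/

theorem HasDerivPlus.congr {α : ℝ} (hα : α ≤ 2) {i : Pair} {f f' u : ℝ → ℝ}
    (h : HasDerivPlus α i f u) (hf : f =ᵐ[muI] f') : HasDerivPlus α i f' u := by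
  cases i
  exacts [HasCaputoPlus.congr h hf, HasCaputoPlus.congr h hf, HasCaputoPlus.congr h hf,
    HasCaputoPlus.congr h hf, HasRLPlus.congr hα h hf, HasRLPlus.congr hα h hf]

theorem HasDerivPlus.unique {α : ℝ} (hα : α ≤ 2) {i : Pair} {f u u' : ℝ → ℝ}
    (h : HasDerivPlus α i f u) (h' : HasDerivPlus α i f u') : u =ᵐ[muI] u' := by
  cases i
  exacts [HasCaputoPlus.unique hα h h', HasCaputoPlus.unique hα h h',
    HasCaputoPlus.unique hα h h', HasCaputoPlus.unique hα h h', HasRLPlus.unique h h',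
    HasRLPlus.unique h h']

/-- The derivative sends `I^α g - k(g) a` back to `g`, so by uniqueness the `g` in the description
of the domain is the image `u` itself. -/
theorem mem_opPlus_iff {α : ℝ} (hα : α ≤ 2) {i : Pair} {a : ℝ → ℝ} {k : (ℝ → ℝ) → ℝ}
    (hdom : domPlus α i = {f : L1I | ∃ g : L1I, f =ᵐ[muI] fun x => intPlus α g x - k g * a x})
    (hderiv : ∀ g : ℝ → ℝ, Integrable g muI → ∀ c : ℝ,
      HasDerivPlus α i (fun x => intPlus α g x + c * a x) g) (f u : L1I) :
    (f, u) ∈ opPlus α i ↔ f =ᵐ[muI] fun x => intPlus α u x - k u * a x := by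
  have hd : ∀ g : L1I, HasDerivPlus α i (fun x => intPlus α g x - k g * a x) g := fun g => by
    simpa only [neg_mul, ← sub_eq_add_neg] using hderiv g (L1.integrable_coeFn g) (-k g)
  simp only [opPlus, hdom, mem_ofPred_eq]
  constructor
  · rintro ⟨⟨g, hg⟩, h⟩
    rwa [Lp.ext ((h.congr hα hg).unique hα (hd g))]
  · exact fun h => ⟨⟨u, h⟩, (hd u).congr hα h.symm⟩

theorem mem_opMinus_iff {α : ℝ} (hα : α ≤ 2) {i : Pair} {b : ℝ → ℝ} {k : (ℝ → ℝ) → ℝ}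
    (hdom : domMinus α i = {f : C0 i | ∃ g : C0 i, ∀ x : i.Omega,
      f x = intMinus α (ext g) x - k (ext g) * b x})
    (hderiv : ∀ g : ℝ → ℝ, Integrable g muI → ∀ c : ℝ,
      HasCaputoMinus α (fun x => intMinus α g x + c * b x) g) (φ ψ : C0 i) :
    (φ, ψ) ∈ opMinus α i ↔ ∀ x : i.Omega, φ x = intMinus α (ext ψ) x - k (ext ψ) * b x := by
  have hd : ∀ g : C0 i,
      HasCaputoMinus α (fun x => intMinus α (ext g) x - k (ext g) * b x) (ext g) := fun g => by
    simpa only [neg_mul, ← sub_eq_add_neg] using hderiv _ (integrable_ext g) (-k (ext g))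
  simp only [opMinus, hdom, mem_ofPred_eq]
  constructor
  · rintro ⟨⟨g, hg⟩, h⟩
    rwa [eq_of_ext_ae_eq ((h.congr (ext_ae_eq (F := fun x => _ - _ * b x) hg)).unique hα (hd g))]
  · exact fun h => ⟨⟨ψ, h⟩, (hd ψ).congr (ext_ae_eq (F := fun x => _ - _ * b x) h).symm⟩

theorem intPlus_sub_const_mul_pPlus {α : ℝ} (hα : 1 < α) {g : ℝ → ℝ} (hg : Integrable g muI)
    (k : ℝ) {x : ℝ} (hx : x ∈ Icc (-1) 1) :
    intPlus α (fun s => g s + -k) x = intPlus α g x - k * pPlus α x := by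
  have h := intPlus_const_mul (ν := α) (-k) (fun _ => 1) x
  simp only [mul_one] at h
  rw [intPlus_add hα.le hg (integrable_const _) hx, h, intPlus_one_fun (by linarith) hx]
  ring

theorem intMinus_sub_const_mul_pMinus {α : ℝ} (hα : 1 < α) {g : ℝ → ℝ} (hg : Integrable g muI)
    (k : ℝ) {x : ℝ} (hx : x ∈ Icc (-1) 1) :
    intMinus α (fun s => g s + -k) x = intMinus α g x - k * pMinus α x := by
  have h := intMinus_const_mul (ν := α) (-k) (fun _ => 1) x
  simp only [mul_one] at h
  rw [intMinus_add hα.le hg (integrable_const _) hx, h, intMinus_one_fun (by linarith) hx]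
  ring

theorem intPlus_order_one_right (g : ℝ → ℝ) : intPlus 1 g 1 = ∫ x, g x ∂muI := by
  rw [intPlus_one_right one_pos]
  simp [pMinus_zero]

theorem pPlus_one_right : pPlus 1 1 = 2 := by
  norm_num [pPlus, Real.Gamma_two]

theorem pMinus_neg_one_eq (β : ℝ) : pMinus β (-1) = pPlus β 1 := by
  simp [pMinus, pPlus]

theorem pPlus_right_ne_zero {β : ℝ} (hβ : -1 < β) : pPlus β 1 ≠ 0 := by
  have := Real.Gamma_pos_of_pos (show 0 < β + 1 by linarith)
  unfold pPlus
  positivity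

theorem intMinus_right (ν : ℝ) (hν : 0 < ν) (f : ℝ → ℝ) : intMinus ν f 1 = 0 := by
  simp [intMinus, hν.ne']

theorem pMinus_right {β : ℝ} (hβ : 0 < β) : pMinus β 1 = 0 := by
  simp [pMinus, Real.zero_rpow hβ.ne']

theorem integral_pPlus {β : ℝ} (hβ : -1 < β) : ∫ x, pPlus β x ∂muI = pPlus (β + 1) 1 := by
  have h := intMinus_neg_one (show 0 < β + 1 by linarith) fun _ => 1
  rw [intMinus_one_fun (by linarith) (by simp), pMinus_neg_one_eq] at h
  simpa using h.symm

/-- Since `p_α = I^α 1`, the correction amounts to replacing `g` by `g - k`. As `p_1(1) = 2`, `k` is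
the mean of `g`, so the image is exactly of mean zero. -/
theorem mem_opPlus_iff_of_neumann {α : ℝ} (hα1 : 1 < α) (hα2 : α ≤ 2) {i : Pair} {a : ℝ → ℝ}
    (hdom : domPlus α i = {f : L1I | ∃ (g : L1I) (c : ℝ), f =ᵐ[muI] fun x =>
      intPlus α g x - intPlus 1 g 1 / pPlus 1 1 * pPlus α x + c * a x})
    (hderiv : ∀ g : ℝ → ℝ, Integrable g muI → ∀ c : ℝ,
      HasDerivPlus α i (fun x => intPlus α g x + c * a x) g) (f u : L1I) :
    (f, u) ∈ opPlus α i ↔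
      ∫ x, u x ∂muI = 0 ∧ ∃ c : ℝ, f =ᵐ[muI] fun x => intPlus α u x + c * a x := by
  simp only [opPlus, hdom, mem_ofPred_eq]
  constructor
  · rintro ⟨⟨g, c, hf⟩, h⟩
    have hg := L1.integrable_coeFn g
    set k := intPlus 1 g 1 / pPlus 1 1 with hk
    have hgk : Integrable (fun x => g x + -k) muI := hg.add (integrable_const _)
    have hf' : f =ᵐ[muI] fun x => intPlus α (fun s => g s + -k) x + c * a x := by
      filter_upwards [hf, ae_mem_Icc] with x hx hx'
      rw [hx, intPlus_sub_const_mul_pPlus hα1 hg k hx']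
    have hu := (h.congr hα2 hf').unique hα2 (hderiv _ hgk c)
    refine ⟨?_, c, ?_⟩
    · rw [integral_congr_ae hu, integral_add hg (integrable_const _), integral_const_muI, hk,
        intPlus_order_one_right, pPlus_one_right]
      ring
    · filter_upwards [hf', ae_mem_Icc] with x hx hx'
      rw [hx, intPlus_congr (by linarith) hu hx']
  · rintro ⟨h0, c, hf⟩
    refine ⟨⟨u, c, ?_⟩, (hderiv _ (L1.integrable_coeFn u) c).congr hα2 hf.symm⟩
    simpa [intPlus_order_one_right, h0] using hf

/-- Here `k` is chosen so that `g - k` is orthogonal to `p⁺_β`, because `∫ p⁺_β = p⁻_{β+1}(-1)`. The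
value `β = 0` gives the condition N, and `β = α - 2` gives N*. -/
theorem mem_opMinus_iff_of_neumann {α : ℝ} (hα1 : 1 < α) (hα2 : α ≤ 2) {i : Pair} {β : ℝ}
    (hβ : -1 < β)
    (hdom : domMinus α i = {f : C0 i | ∃ (g : C0 i) (c : ℝ), ∀ x : i.Omega,
      f x = intMinus α (ext g) x -
      intMinus (β + 1) (ext g) (-1) / pMinus (β + 1) (-1) * pMinus α x + c * pMinus 0 x})
    (φ ψ : C0 i) :
    (φ, ψ) ∈ opMinus α i ↔ ∫ x, ext ψ x * pPlus β x ∂muI = 0 ∧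
      ∃ c : ℝ, ∀ x : i.Omega, φ x = intMinus α (ext ψ) x + c := by
  have hβ' : 0 < β + 1 := by linarith
  have hb : ∀ g, intMinus (β + 1) g (-1) = ∫ x, g x * pPlus β x ∂muI := fun g => by
    rw [intMinus_neg_one hβ', add_sub_cancel_right]
  simp only [opMinus, hdom, mem_ofPred_eq]
  constructor
  · rintro ⟨⟨g, c, hf⟩, h⟩
    have hg := integrable_ext g
    set k := intMinus (β + 1) (ext g) (-1) / pMinus (β + 1) (-1) with hk
    have hgk : Integrable (fun x => ext g x + -k) muI := hg.add (integrable_const _)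
    have hf' : ∀ x : i.Omega, φ x = intMinus α (fun s => ext g s + -k) x + c * pMinus 0 x := by
      intro x
      rw [hf, intMinus_sub_const_mul_pMinus hα1 hg k (Omega_subset_Icc i x.2)]
    have hu := (h.congr (ext_ae_eq (F := fun x => intMinus α _ x + c * pMinus 0 x) hf')).unique hα2
      (hasCaputoMinus_intMinus_add_const hα1 hα2 hgk c)
    refine ⟨?_, c, fun x => ?_⟩
    · rw [integral_mul_congr hu (ae_eq_refl _)]
      simp only [add_mul]
      rw [integral_add (integrable_ext_mul' g (integrable_pPlus hβ))
        ((integrable_pPlus hβ).const_mul _), integral_const_mul, integral_pPlus hβ, hk, hb,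
        pMinus_neg_one_eq]
      have := pPlus_right_ne_zero (show -1 < β + 1 by linarith)
      field_simp
      ring
    · rw [hf', intMinus_congr (by linarith) hu (Omega_subset_Icc i x.2), pMinus_zero, mul_one]
  · rintro ⟨h0, c, hf⟩
    have hf' : ∀ x : i.Omega, φ x = intMinus α (ext ψ) x + c * pMinus 0 x := fun x => by
      rw [hf, pMinus_zero, mul_one]
    refine ⟨⟨ψ, c, fun x => ?_⟩,
      (hasCaputoMinus_intMinus_add_const hα1 hα2 (integrable_ext ψ) c).congr
        (ext_ae_eq (F := fun x => _ + c * pMinus 0 x) hf').symm⟩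
    rw [hf', hb, h0]
    ring

/-! ### The six pairs -/

/-- The two normalising constants agree, so either one can be absorbed into `b`. -/
theorem adjoint_caputoDD {α : ℝ} (hα1 : 1 < α) (hα2 : α ≤ 2) :
    opMinus α .caputoDD = partIn (pairing .caputoDD) (adjoint (opPlus α .caputoDD)) ∧
      opPlus α .caputoDD =
        partIn (pairing .caputoDD).flip (adjoint (opMinus α .caputoDD)) := by
  have h1 : ∀ g : ℝ → ℝ, ∫ s, pMinus (α - 1) s / pPlus (α - 1) 1 * g s ∂muI =
      intPlus α g 1 / pPlus (α - 1) 1 := fun g => by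
    rw [intPlus_one_right (by linarith), ← integral_div]
    simp only [div_mul_eq_mul_div]
  have h2 : ∀ (g : ℝ → ℝ) (x : ℝ),
      (∫ s, g s * pPlus (α - 1) s ∂muI) * (pMinus (α - 1) x / pPlus (α - 1) 1) =
        intMinus α g (-1) / pMinus (α - 1) (-1) * pMinus (α - 1) x := fun g x => by
    rw [← intMinus_neg_one (by linarith), pMinus_neg_one_eq]
    ring
  refine adjoint_rankOne hα1 .caputoDD (a := pPlus (α - 1))
    (b := fun x => pMinus (α - 1) x / pPlus (α - 1) 1) (integrable_pPlus (by linarith))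
    ((continuous_pMinus (by linarith)).div_const _).continuousOn (fun f g => ?_) (fun φ ψ => ?_)
    fun ψ x hx hx' => ?_
  · rw [h1, mem_opPlus_iff hα2 (i := .caputoDD) (a := pPlus (α - 1))
      (k := fun g => intPlus α g 1 / pPlus (α - 1) 1) rfl
      fun g hg c => hasCaputoPlus_intPlus_add hα1 hα2 hg c]
  · simp only [h2]
    rw [mem_opMinus_iff hα2 (k := fun g => intMinus α g (-1) / pMinus (α - 1) (-1)) rfl
      fun g hg c => hasCaputoMinus_intMinus_add hα1 hα2 hg c]
  · rw [h2]
    rcases eq_endpoints_or_mem_Ioo_of_mem_Icc hx with rfl | rfl | h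
    · rw [pMinus_neg_one_eq, div_mul_cancel₀ _ (pPlus_right_ne_zero (by linarith)), sub_self]
    · rw [intMinus_right _ (by linarith), pMinus_right (by linarith), mul_zero, sub_zero]
    · exact absurd h hx'

theorem adjoint_caputoDN {α : ℝ} (hα1 : 1 < α) (hα2 : α ≤ 2) :
    opMinus α .caputoDN = partIn (pairing .caputoDN) (adjoint (opPlus α .caputoDN)) ∧
      opPlus α .caputoDN =
        partIn (pairing .caputoDN).flip (adjoint (opMinus α .caputoDN)) := by
  have h1 : ∀ g : ℝ → ℝ, ∫ s, pMinus 0 s * g s ∂muI = intPlus 1 g 1 := fun g => by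
    rw [intPlus_one_right one_pos, sub_self]
  have h2 : ∀ g : ℝ → ℝ, ∫ s, g s * pPlus (α - 1) s ∂muI = intMinus α g (-1) := fun g => by
    rw [← intMinus_neg_one (by linarith)]
  refine adjoint_rankOne hα1 .caputoDN (a := pPlus (α - 1)) (b := pMinus 0)
    (integrable_pPlus (by linarith)) (continuous_pMinus le_rfl).continuousOn (fun f g => ?_)
    (fun φ ψ => ?_) fun ψ x hx hx' => ?_
  · rw [h1, mem_opPlus_iff hα2 (i := .caputoDN) (a := pPlus (α - 1))
      (k := fun g => intPlus 1 g 1) rfl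
      fun g hg c => hasCaputoPlus_intPlus_add hα1 hα2 hg c]
  · simp only [h2]
    rw [mem_opMinus_iff hα2 (k := fun g => intMinus α g (-1)) rfl
      fun g hg c => hasCaputoMinus_intMinus_add_const hα1 hα2 hg c]
  · rw [h2]
    rcases hx.1.eq_or_lt with rfl | h
    · rw [pMinus_zero, mul_one, sub_self]
    · exact absurd ⟨h, hx.2⟩ hx'

theorem adjoint_caputoND {α : ℝ} (hα1 : 1 < α) (hα2 : α ≤ 2) :
    opMinus α .caputoND = partIn (pairing .caputoND) (adjoint (opPlus α .caputoND)) ∧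
      opPlus α .caputoND =
        partIn (pairing .caputoND).flip (adjoint (opMinus α .caputoND)) := by
  have h1 : ∀ g : ℝ → ℝ, ∫ s, pMinus (α - 1) s * g s ∂muI = intPlus α g 1 := fun g => by
    rw [intPlus_one_right (by linarith)]
  have h2 : ∀ g : ℝ → ℝ, ∫ s, g s * pPlus 0 s ∂muI = intMinus 1 g (-1) := fun g => by
    rw [intMinus_neg_one one_pos, sub_self]
  refine adjoint_rankOne hα1 .caputoND (a := pPlus 0) (b := pMinus (α - 1))
    (integrable_pPlus (by norm_num)) (continuous_pMinus (by linarith)).continuousOn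
    (fun f g => ?_) (fun φ ψ => ?_) fun ψ x hx hx' => ?_
  · rw [h1, mem_opPlus_iff hα2 (i := .caputoND) (a := pPlus 0)
      (k := fun g => intPlus α g 1) rfl
      fun g hg c => hasCaputoPlus_intPlus_add_const hα1 hα2 hg c]
  · simp only [h2]
    rw [mem_opMinus_iff hα2 (k := fun g => intMinus 1 g (-1)) rfl
      fun g hg c => hasCaputoMinus_intMinus_add hα1 hα2 hg c]
  · rcases hx.2.eq_or_lt with rfl | h
    · rw [intMinus_right _ (by linarith), pMinus_right (by linarith), mul_zero, sub_zero]
    · exact absurd ⟨hx.1, h⟩ hx'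

/-- The singular function `p⁺_{α-2}` as `a` turns the boundary functional into `I₋^{α-1} ψ(-1)`,
which is how N* arises as the dual of the Riemann-Liouville condition. -/
theorem adjoint_rlND {α : ℝ} (hα1 : 1 < α) (hα2 : α ≤ 2) :
    opMinus α .rlND = partIn (pairing .rlND) (adjoint (opPlus α .rlND)) ∧
      opPlus α .rlND = partIn (pairing .rlND).flip (adjoint (opMinus α .rlND)) := by
  have h1 : ∀ g : ℝ → ℝ, ∫ s, pMinus (α - 1) s / pPlus (α - 2) 1 * g s ∂muI =
      intPlus α g 1 / pPlus (α - 2) 1 := fun g => by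
    rw [intPlus_one_right (by linarith), ← integral_div]
    simp only [div_mul_eq_mul_div]
  have h2 : ∀ (g : ℝ → ℝ) (x : ℝ),
      (∫ s, g s * pPlus (α - 2) s ∂muI) * (pMinus (α - 1) x / pPlus (α - 2) 1) =
        intMinus (α - 1) g (-1) / pMinus (α - 2) (-1) * pMinus (α - 1) x := fun g x => by
    rw [intMinus_neg_one (by linarith), pMinus_neg_one_eq, show α - 1 - 1 = α - 2 by ring]
    ring
  refine adjoint_rankOne hα1 .rlND (a := pPlus (α - 2))
    (b := fun x => pMinus (α - 1) x / pPlus (α - 2) 1) (integrable_pPlus (by linarith))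
    ((continuous_pMinus (by linarith)).div_const _).continuousOn (fun f g => ?_) (fun φ ψ => ?_)
    fun ψ x hx hx' => ?_
  · rw [h1, mem_opPlus_iff hα2 (i := .rlND) (a := pPlus (α - 2))
      (k := fun g => intPlus α g 1 / pPlus (α - 2) 1) rfl
      fun g hg c => hasRLPlus_intPlus_add hα1 hα2 hg c]
  · simp only [h2]
    rw [mem_opMinus_iff hα2 (k := fun g => intMinus (α - 1) g (-1) / pMinus (α - 2) (-1)) rfl
      fun g hg c => hasCaputoMinus_intMinus_add hα1 hα2 hg c]
  · rcases hx.2.eq_or_lt with rfl | h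
    · rw [intMinus_right _ (by linarith), pMinus_right (by linarith), zero_div, mul_zero,
        sub_zero]
    · exact absurd ⟨hx.1, h⟩ hx'

theorem adjoint_caputoNN {α : ℝ} (hα1 : 1 < α) (hα2 : α ≤ 2) :
    opMinus α .caputoNN = partIn (pairing .caputoNN) (adjoint (opPlus α .caputoNN)) ∧
      opPlus α .caputoNN =
        partIn (pairing .caputoNN).flip (adjoint (opMinus α .caputoNN)) := by
  refine adjoint_of_kernel hα1 .caputoNN rfl (a := pPlus 0) (integrable_pPlus (by norm_num)) ?_
    (mem_opPlus_iff_of_neumann hα1 hα2 rfl fun g hg c =>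
      hasCaputoPlus_intPlus_add_const hα1 hα2 hg c)
    (mem_opMinus_iff_of_neumann hα1 hα2 (by norm_num) ?_)
  · rw [integral_pPlus (by norm_num)]
    exact pPlus_right_ne_zero (by norm_num)
  · simp only [zero_add]
    rfl

theorem adjoint_rlNN {α : ℝ} (hα1 : 1 < α) (hα2 : α ≤ 2) :
    opMinus α .rlNN = partIn (pairing .rlNN) (adjoint (opPlus α .rlNN)) ∧
      opPlus α .rlNN = partIn (pairing .rlNN).flip (adjoint (opMinus α .rlNN)) := by
  refine adjoint_of_kernel hα1 .rlNN rfl (a := pPlus (α - 2)) (integrable_pPlus (by linarith)) ?_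
    (mem_opPlus_iff_of_neumann hα1 hα2 rfl fun g hg c => hasRLPlus_intPlus_add hα1 hα2 hg c)
    (mem_opMinus_iff_of_neumann hα1 hα2 (by linarith) ?_)
  · rw [integral_pPlus (by linarith)]
    exact pPlus_right_ne_zero (by linarith)
  · rw [show α - 2 + 1 = α - 1 by ring]
    rfl

end FracBC

theorem mainTheorem3 (α : ℝ) (hα1 : 1 < α) (hα2 : α ≤ 2) (i : FracBC.Pair) :
    FracBC.opMinus α i =
        FracBC.partIn (FracBC.pairing i) (FracBC.adjoint (FracBC.opPlus α i)) ∧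
      FracBC.opPlus α i =
        FracBC.partIn (FracBC.pairing i).flip (FracBC.adjoint (FracBC.opMinus α i)) := by
  cases i
  exacts [FracBC.adjoint_caputoDD hα1 hα2, FracBC.adjoint_caputoDN hα1 hα2,
    FracBC.adjoint_caputoND hα1 hα2, FracBC.adjoint_caputoNN hα1 hα2,
    FracBC.adjoint_rlND hα1 hα2, FracBC.adjoint_rlNN hα1 hα2]
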